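/- **Setting.** Let $N\ge 1$, $\alpha\in\mathbb C\setminus\{0\}$ and $\sigma_h,\sigma,\bar E>0$. Let $h_r,h_t,h_b\sim\mathcal{CN}(0,\sigma_h^2)$ be the (Rayleigh) fading components, and put $h_0=h_r$, $h_1=h_r+\alpha h_bh_t$, $\mu=|h_0|^2$, $\nu=|h_1|^2$. When the on-off bit $b\in\{0,1\}$ is sent during a symbol period of $N$ samples, the receiver observes $y(n)=g_b\,x(n)+w(n)$, $1\le n\le N$, where $g_0=h_0$, $g_1=h_1$, the noise samples $w(n)\sim\mathcal{CN}(0,\sigma^2)$ are i.i.d., and the ambient signal satisfies $\frac1N\sum_{n=1}^N|x(n)|^2=\bar E$ almost surely in each period; it computes $Y=\frac1N\sum_{n=1}^N|y(n)|^2$. Fading components, source bits (independent, equally likely), ambient signal and noise are mutually independent. Let $T(\mu,\nu)\ge 0$ be any measurable threshold. * Receiver $\mathcal R_1$ (with CSI) declares $\hat b=1$ if $Y\ge T(\mu,\nu)$ and $\hat b=0$ otherwise when $\nu\ge\mu$, and declares $\hat b=1$ if $Y<T(\mu,\nu)$ and $\hat b=0$ otherwise when $\nu<\mu$. Its average BER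 is $P_{\mathcal R_1}(e)=P(\hat b\ne b)$. * Receiver $\mathcal R_2$ (without CSI) observes two consecutive symbol periods with the same fading, carrying a bit $b'$ and the differentially encoded bit $b'\oplus m$, where $b'$ and the message bit $m$ are independent and equally likely; it declares each of the two symbols to be $1$ if and only if the corresponding $Y\ge T(\mu,\nu)$, and decodes $\hat m$ as the exclusive or of the two detected symbols. Its average BER is $P_{\mathcal R_2}(e)=P(\hat m\neq m)$. Let $I_n(z)=\left(\frac z2\right)^n\sum_{i\ge0}\frac{(z^2/4)^i}{i!\,(n+i)!}$, let $K_0(z)=\int_0^\infty e^{-z\cosh t}\,dt$ ($z>0$) be the modified Bessel function of the second kind of order zero, and let $$Q_M(a,b)=\frac1{a^{M-1}}\int_b^\infty v^M e^{-\frac{v^2+a^2}{2}}I_{M-1}(av)\,dv$$ be the generalized Marcum Q-function. Put $$f(\mu,\nu)=\frac{1}{\pi\sigma_h^2}e^{-\mu/\sigma_h^2}\,\frac{1}{2\pi(|\alpha|\sigma_h^2)^2}\int_0^{2\pi}\!\!\int_0^{2\pi}K_0\!\left(\frac{\sqrt{\mu+\nu-2\sqrt{\mu\nu}\cos(\theta_1-\theta_0)}}{|\alpha|\sigma_h^2/2}\right)d\theta_1\,d\theta_0,$$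 $$q_\mu=Q_N\!\left(\sqrt{2N\tfrac{\mu\bar E}{\sigma^2}},\sqrt{2N\tfrac{T(\mu,\nu)}{\sigma^2}}\right),\qquad q_\nu=Q_N\!\left(\sqrt{2N\tfrac{\nu\bar E}{\sigma^2}},\sqrt{2N\tfrac{T(\mu,\nu)}{\sigma^2}}\right).$$ **Theorem.** All the integrands below are integrable on the indicated regions of $(0,\infty)^2$, and $$P_{\mathcal R_1}(e)=\int_0^\infty\!\!\int_0^{\mu}f(\mu,\nu)\,\tfrac12\{1+q_\nu-q_\mu\}\,d\nu\,d\mu+\int_0^\infty\!\!\int_\mu^{\infty}f(\mu,\nu)\,\tfrac12\{1+q_\mu-q_\nu\}\,d\nu\,d\mu,$$ $$P_{\mathcal R_2}(e)=\int_0^\infty\!\!\int_0^{\infty}f(\mu,\nu)\left(\tfrac12-\tfrac12\{q_\nu-q_\mu\}^2\right)d\nu\,d\mu.$$ -/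

import Mathlib

open MeasureTheory ProbabilityTheory

namespace AmbientBackscatter

noncomputable section

/-! ### Special functions -/

/-- Modified Bessel function of the first kind of integer order `n`:
`I_n(z) = (z/2)^n ∑ (z²/4)^i / (i! Γ(n+i+1))`. -/
def besselI (n : ℕ) (z : ℝ) : ℝ :=
  (z / 2) ^ n * ∑' i : ℕ, (z ^ 2 / 4) ^ i / ((i.factorial : ℝ) * ((n + i).factorial : ℝ))

/-- Modified Bessel function of the second kind of order zero, for `z > 0`:
`K_0(z) = ∫_0^∞ exp(-z cosh t) dt`. -/
def besselK0 (z : ℝ) : ℝ :=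
  ∫ t in Set.Ioi (0 : ℝ), Real.exp (-z * Real.cosh t)

/-- Generalized Marcum Q-function of degree `M ≥ 1`, for `a > 0` and `b ≥ 0`:
`Q_M(a,b) = a^{-(M-1)} ∫_b^∞ v^M exp(-(v²+a²)/2) I_{M-1}(a v) dv`. -/
def marcumQ (M : ℕ) (a b : ℝ) : ℝ :=
  1 / a ^ (M - 1) *
    ∫ v in Set.Ioi b, v ^ M * Real.exp (-(v ^ 2 + a ^ 2) / 2) * besselI (M - 1) (a * v)

/-! ### Laws -/

/-- The circularly symmetric complex Gaussian law `CN(0, v)`: real and imaginary parts are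
independent, each `N(0, v/2)`. -/
def complexGaussian (v : ℝ) : Measure ℂ :=
  ((gaussianReal 0 (v / 2).toNNReal).prod (gaussianReal 0 (v / 2).toNNReal)).map
    (fun p : ℝ × ℝ => (⟨p.1, p.2⟩ : ℂ))

/-- The law of an equally likely bit. -/
def fairBit : Measure Bool := (PMF.uniformOfFintype Bool).toMeasure

/-! ### The ambient backscatter link -/

/-- The random objects of an ambient backscatter link observed over `K` consecutive symbol periods
of `N` samples each: the fading components of the links source-receiver (`hr`),
source-transmitter (`ht`) and transmitter-receiver (`hb`), constant over the `K` periods; the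
source bits; the ambient signal `x`; and the additive noise `w`. -/
structure Link (Ω : Type*) (N K : ℕ) where
  hr : Ω → ℂ
  ht : Ω → ℂ
  hb : Ω → ℂ
  src : Ω → Fin K → Bool
  x : Ω → Fin K → Fin N → ℂ
  w : Ω → Fin K → Fin N → ℂ

namespace Link

variable {Ω : Type*} {N K : ℕ}

/-- Rayleigh fading model: the fading components are `CN(0, σh²)`, the source bits are fair, the
noise samples are `CN(0, σ²)`, the ambient signal has an arbitrary law, and all of these are
mutually independent (only the samples of the ambient signal may depend on each other); the average
energy of the ambient signal over each symbol period is the constant `E`. -/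
structure IsRayleigh [MeasurableSpace Ω] (L : Link Ω N K) (P : Measure Ω) (σh σ E : ℝ) :
    Prop where
  measurable_hr : Measurable L.hr
  measurable_ht : Measurable L.ht
  measurable_hb : Measurable L.hb
  measurable_src : Measurable L.src
  measurable_x : Measurable L.x
  measurable_w : Measurable L.w
  joint_law :
    P.map (fun ω => (L.hr ω, L.ht ω, L.hb ω, L.src ω, L.x ω, L.w ω)) =
      (complexGaussian (σh ^ 2)).prod ((complexGaussian (σh ^ 2)).prod
        ((complexGaussian (σh ^ 2)).prod ((Measure.pi fun _ : Fin K => fairBit).prod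
          ((P.map L.x).prod
            (Measure.pi fun _ : Fin K => Measure.pi fun _ : Fin N => complexGaussian (σ ^ 2))))))
  avg_energy : ∀ᵐ ω ∂P, ∀ k, (1 / (N : ℝ)) * ∑ n, ‖L.x ω k n‖ ^ 2 = E

/-- The fading component `h_r + α h_b b h_t` seen by the receiver when the bit `b` is sent, where
`α` is the reflection coefficient. -/
def gain (L : Link Ω N K) (α : ℂ) (b : Bool) (ω : Ω) : ℂ :=
  L.hr ω + α * L.hb ω * (if b then 1 else 0) * L.ht ω

/-- `μ = |h_0|²`. -/
def mu (L : Link Ω N K) (α : ℂ) (ω : Ω) : ℝ := ‖L.gain α false ω‖ ^ 2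

/-- `ν = |h_1|²`. -/
def nu (L : Link Ω N K) (α : ℂ) (ω : Ω) : ℝ := ‖L.gain α true ω‖ ^ 2

/-- Average energy `Y = (1/N) ∑ |y(n)|²` received in period `k` when the bit `b` is sent there. -/
def energy (L : Link Ω N K) (α : ℂ) (k : Fin K) (b : Bool) (ω : Ω) : ℝ :=
  (1 / (N : ℝ)) * ∑ n, ‖L.gain α b ω * L.x ω k n + L.w ω k n‖ ^ 2

end Link

/-! ### Receivers -/

/-- Detection with CSI: the receiver knows which hypothesis has the larger fading component and
assigns energies above the threshold `t` to that hypothesis. -/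
def detectCSI (μ ν t y : ℝ) : Bool :=
  if ν < μ then decide (y < t) else decide (t ≤ y)

/-- Detection without CSI: energies above the threshold `t` are always declared to be `1`. -/
def detect (t y : ℝ) : Bool := decide (t ≤ y)

/-- Average bit error rate of the receiver with CSI: the source bit is sent as it is. -/
def berCSI {Ω : Type*} [MeasurableSpace Ω] {N : ℕ} (L : Link Ω N 1) (P : Measure Ω) (α : ℂ)
    (T : ℝ → ℝ → ℝ) : ℝ :=
  P.real {ω | detectCSI (L.mu α ω) (L.nu α ω) (T (L.mu α ω) (L.nu α ω))
    (L.energy α 0 (L.src ω 0) ω) ≠ L.src ω 0}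

/-- Average bit error rate of the receiver without CSI. The transmitter sends the reference symbol
`b' = src 0` in the first period and the differentially encoded symbol `b' xor m`, where
`m = src 1` is the message bit, in the second one; the receiver decodes `m` as the exclusive or of
the two detected symbols. -/
def berNoCSI {Ω : Type*} [MeasurableSpace Ω] {N : ℕ} (L : Link Ω N 2) (P : Measure Ω) (α : ℂ)
    (T : ℝ → ℝ → ℝ) : ℝ :=
  P.real {ω |
    xor (detect (T (L.mu α ω) (L.nu α ω))
          (L.energy α 1 (xor (L.src ω 0) (L.src ω 1)) ω))
        (detect (T (L.mu α ω) (L.nu α ω)) (L.energy α 0 (L.src ω 0) ω))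
      ≠ L.src ω 1}

/-! ### The expressions in the result -/

/-- The joint density of `(μ, ν)`; `a` stands for `|α|`. -/
def jointDensity (a σh μ ν : ℝ) : ℝ :=
  1 / (Real.pi * σh ^ 2) * Real.exp (-μ / σh ^ 2) * (1 / (2 * Real.pi * (a * σh ^ 2) ^ 2)) *
    ∫ θ₀ in (0 : ℝ)..(2 * Real.pi), ∫ θ₁ in (0 : ℝ)..(2 * Real.pi),
      besselK0 (Real.sqrt (μ + ν - 2 * Real.sqrt (μ * ν) * Real.cos (θ₁ - θ₀)) /
        (a * σh ^ 2 / 2))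

/-- `Q_N(√(2N s E / σ²), √(2N t / σ²))`. -/
def tailQ (N : ℕ) (E σ s t : ℝ) : ℝ :=
  marcumQ N (Real.sqrt (2 * N * (s * E / σ ^ 2))) (Real.sqrt (2 * N * (t / σ ^ 2)))

end

end AmbientBackscatter

open AmbientBackscatter

namespace AmbientBackscatter

open scoped ENNReal NNReal

-- Condition on the fading, the bits and the ambient signal. The noise is then the only randomness.
-- The energy of `N` independent complex Gaussian samples with prescribed means depends on those
-- means only through their total energy. For sent bit `c` this is `N E` times the squared gain, so
-- `P(Y ≥ T)` is a function of `(μ, ν)` alone, and the law of `x` disappears.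
--
-- This function is the Marcum Q-function. Characteristic functions identify the normalized energy
-- with a Poisson mixture of gamma laws (`map_sum_norm_add_sq`). The substitution `u = v² / 2` turns
-- the tail of the mixture, term by term, into the power series of `besselI` under the Marcum
-- integral (`marcumQ_eq_noncentralGamma`).
--
-- The density of `(μ, ν)` comes from two changes of variables. Given `h_t = u`, the product `α h_b
-- h_t` is a Gaussian scaled by `α u`; averaging over `u` leaves an integral in `|u|²` which is
-- `K_0` after an exponential substitution (`lintegral_product_complexGaussian`). Thus `(h_0, h_1)`
-- has density `p(h_0) k(h_1 - h_0)`, with `p` the Gaussian density and `k` that of the product.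
-- Polar coordinates in both variables and the law of cosines give `jointDensity`
-- (`lintegral_fading`).
--
-- Averaging over the fair bits is then algebra: the receiver with CSI makes an error on a tail
-- event or on its complement, the one without CSI according to the exclusive or of two
-- conditionally independent tail events. Everything is computed with nonnegative lower integrals.
-- The totals are probabilities, so integrability comes for free, and Fubini gives the iterated
-- form.

-- Complex Gaussian laws

/-- The density of `CN(0, v)` with respect to Lebesgue measure on `ℂ`. -/
noncomputable def complexGaussianDensity (v : ℝ) (z : ℂ) : ℝ :=
  1 / (Real.pi * v) * Real.exp (-‖z‖ ^ 2 / v)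

lemma complexGaussianDensity_nonneg {v : ℝ} (hv : 0 < v) (z : ℂ) :
    0 ≤ complexGaussianDensity v z := by
  unfold complexGaussianDensity; positivity

@[fun_prop]
lemma measurable_complexGaussianDensity (v : ℝ) : Measurable (complexGaussianDensity v) := by
  unfold complexGaussianDensity; fun_prop

lemma complexGaussian_eq_withDensity {v : ℝ} (hv : 0 < v) :
    complexGaussian v =
      volume.withDensity (fun z => ENNReal.ofReal (complexGaussianDensity v z)) := by
  have hne : (v / 2).toNNReal ≠ 0 := by simpa using hv
  have hco : ((v / 2).toNNReal : ℝ) = v / 2 := Real.coe_toNNReal _ (by positivity)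
  have key := Complex.volume_preserving_equiv_real_prod.symm
  unfold complexGaussian
  rw [gaussianReal_of_var_ne_zero _ hne,
    prod_withDensity (measurable_gaussianPDF _ _) (measurable_gaussianPDF _ _)]
  ext s hs
  have hm : Measurable (fun p : ℝ × ℝ => (⟨p.1, p.2⟩ : ℂ)) :=
    Complex.measurableEquivRealProd.symm.measurable
  rw [Measure.map_apply hm hs, withDensity_apply _ (hm hs), withDensity_apply _ hs,
    ← key.setLIntegral_comp_preimage_emb Complex.measurableEquivRealProd.symm.measurableEmbedding]
  refine lintegral_congr fun p => ?_
  simp only [gaussianPDF, gaussianPDFReal, hco, complexGaussianDensity]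
  rw [← ENNReal.ofReal_mul (by positivity)]
  congr 1
  have h1 : ‖(Complex.measurableEquivRealProd.symm p : ℂ)‖ ^ 2 = p.1 ^ 2 + p.2 ^ 2 := by
    rw [← Complex.normSq_eq_norm_sq]
    simp [Complex.normSq_apply, Complex.measurableEquivRealProd_symm_apply]
    ring
  rw [h1, mul_mul_mul_comm, ← Real.exp_add, ← mul_inv, Real.mul_self_sqrt (by positivity)]
  congr 1
  · field_simp
  · congr 1; field_simp; ring

lemma isProbabilityMeasure_complexGaussian (v : ℝ) : IsProbabilityMeasure (complexGaussian v) := by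
  unfold complexGaussian
  exact Measure.isProbabilityMeasure_map
    Complex.measurableEquivRealProd.symm.measurable.aemeasurable

lemma lintegral_complexGaussian {v : ℝ} (hv : 0 < v) {F : ℂ → ℝ≥0∞} (hF : Measurable F) :
    ∫⁻ z, F z ∂complexGaussian v =
      ∫⁻ z, ENNReal.ofReal (complexGaussianDensity v z) * F z := by
  rw [complexGaussian_eq_withDensity hv, lintegral_withDensity_eq_lintegral_mul _ (by fun_prop) hF]
  rfl

lemma one_sub_ofReal_mul_I_ne_zero (t : ℝ) : (1 - t * Complex.I : ℂ) ≠ 0 := by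
  intro h
  simpa using congrArg Complex.re h

/-- Characteristic function of `‖z + w‖² / v` for `w` of law `CN(0, v)`. -/
lemma integral_cexp_norm_add_sq_complexGaussian {v : ℝ} (hv : 0 < v) (z : ℂ) (t : ℝ) :
    ∫ w, Complex.exp (t * (‖z + w‖ ^ 2 / v : ℝ) * Complex.I) ∂complexGaussian v =
      (1 - t * Complex.I)⁻¹ *
        Complex.exp ((‖z‖ ^ 2 / v : ℝ) * ((1 - t * Complex.I)⁻¹ - 1)) := by
  have hvC : (v : ℂ) ≠ 0 := by exact_mod_cast hv.ne'
  have h1 := one_sub_ofReal_mul_I_ne_zero t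
  have hb : 0 < ((1 - t * Complex.I) / v : ℂ).re := by
    rw [Complex.div_ofReal_re]; simpa using hv
  rw [complexGaussian_eq_withDensity hv,
    integral_withDensity_eq_integral_toReal_smul (by fun_prop) (by simp)]
  simp_rw [ENNReal.toReal_ofReal (complexGaussianDensity_nonneg hv _)]
  -- Translating by `z` moves the shift from the norm into the density: the exponent becomes a
  -- multiple of `‖w‖ ^ 2` plus a real linear form, a standard Gaussian integral over a real plane.
  rw [← integral_sub_right_eq_self _ z]
  have key : ∀ w : ℂ, complexGaussianDensity v (w - z) •
      Complex.exp (t * (‖z + (w - z)‖ ^ 2 / v : ℝ) * Complex.I) =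
      (1 / (Real.pi * v) * Complex.exp (-(‖z‖ ^ 2 / v : ℝ)) : ℂ) *
        Complex.exp (-((1 - t * Complex.I) / v) * ‖w‖ ^ 2 + (2 / v : ℂ) * (inner ℝ z w : ℝ)) := by
    intro w
    have h2 : ‖w - z‖ ^ 2 = ‖w‖ ^ 2 - 2 * (inner ℝ z w : ℝ) + ‖z‖ ^ 2 := by
      rw [norm_sub_sq_real, real_inner_comm]
    rw [add_sub_cancel, complexGaussianDensity, h2, Complex.real_smul]
    push_cast
    rw [mul_assoc, mul_assoc (1 / _ : ℂ), ← Complex.exp_add, ← Complex.exp_add]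
    congr 2
    field_simp
    ring
  simp_rw [key]
  rw [integral_const_mul, GaussianFourier.integral_cexp_neg_mul_sq_norm_add hb,
    Complex.finrank_real_complex]
  have h3 : (((2 : ℕ) : ℂ) / 2) = 1 := by norm_num
  rw [h3, Complex.cpow_one]
  push_cast
  have h4 : (‖z‖ ^ 2 / v * ((1 - t * Complex.I)⁻¹ - 1) : ℂ) =
      -(‖z‖ ^ 2 / v) + (2 / v) ^ 2 * ‖z‖ ^ 2 / (4 * ((1 - t * Complex.I) / v)) := by
    field_simp
    ring
  rw [h4, Complex.exp_add]
  field_simp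

-- Gamma laws, their Poisson mixtures and the energy of Gaussian samples

/-- The standard gamma law with integer shape `k + 1`. -/
noncomputable def erlang (k : ℕ) : Measure ℝ :=
  (volume.restrict (Set.Ioi 0)).withDensity
    fun u => ENNReal.ofReal (u ^ k / (k.factorial : ℝ) * Real.exp (-u))

lemma hasDerivAt_pow_mul_cexp (z : ℂ) (n : ℕ) (u : ℝ) :
    HasDerivAt (fun u : ℝ => (u : ℂ) ^ (n + 1) * Complex.exp (-z * u))
      ((n + 1) * (u ^ n * Complex.exp (-z * u)) - z * (u ^ (n + 1) * Complex.exp (-z * u))) u := by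
  have h1 : HasDerivAt (fun u : ℝ => (u : ℂ)) 1 u := Complex.ofRealCLM.hasDerivAt
  have h2 := (h1.pow (n + 1)).mul ((h1.const_mul (-z)).cexp)
  convert! h2 using 1
  push_cast
  simp
  ring

lemma integrableOn_pow_mul_cexp {z : ℂ} (hz : 0 < z.re) (n : ℕ) :
    IntegrableOn (fun u : ℝ => (u : ℂ) ^ n * Complex.exp (-z * u)) (Set.Ioi 0) := by
  have h := integrableOn_rpow_mul_exp_neg_mul_rpow (s := n) (p := 1) (b := z.re)
    (by have : (0 : ℝ) ≤ n := n.cast_nonneg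
        linarith) one_pos hz
  refine Integrable.mono' h (by fun_prop) ?_
  filter_upwards [ae_restrict_mem measurableSet_Ioi] with u hu
  rw [norm_mul, norm_pow, Complex.norm_exp]
  simp [abs_of_pos (show (0 : ℝ) < u from hu)]

/-- Integration by parts gives the recursion in `n`. The rate is complex because the characteristic
function of the gamma law is needed, at `z = 1 - t i`. -/
lemma integral_pow_mul_cexp {z : ℂ} (hz : 0 < z.re) (n : ℕ) :
    ∫ u in Set.Ioi (0 : ℝ), (u : ℂ) ^ n * Complex.exp (-z * u) = n.factorial / z ^ (n + 1) := by
  have hz0 : z ≠ 0 := by rintro rfl; simp at hz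
  induction n with
  | zero =>
    have := integral_exp_mul_complex_Ioi (a := -z) (by simpa using hz) 0
    simp only [pow_zero, one_mul, this]
    simp
  | succ n ih =>
    have hlim : Filter.Tendsto (fun u : ℝ => (u : ℂ) ^ (n + 1) * Complex.exp (-z * u))
        Filter.atTop (nhds 0) := by
      rw [tendsto_zero_iff_norm_tendsto_zero]
      refine (tendsto_rpow_mul_exp_neg_mul_atTop_nhds_zero (n + 1 : ℕ) z.re hz).congr' ?_
      filter_upwards [Filter.eventually_gt_atTop 0] with u hu
      rw [norm_mul, norm_pow, Complex.norm_exp, Real.rpow_natCast]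
      simp [abs_of_pos hu]
    have h := integral_Ioi_of_hasDerivAt_of_tendsto'
      (fun u _ => hasDerivAt_pow_mul_cexp z n u)
      (((integrableOn_pow_mul_cexp hz n).const_mul _).sub
        ((integrableOn_pow_mul_cexp hz (n + 1)).const_mul _)) hlim
    rw [integral_sub ((integrableOn_pow_mul_cexp hz n).const_mul _)
        ((integrableOn_pow_mul_cexp hz (n + 1)).const_mul _), integral_const_mul,
      integral_const_mul, ih] at h
    simp at h
    rw [Nat.factorial_succ]
    push_cast
    field_simp at h ⊢
    linear_combination -h

lemma integral_cexp_erlang (k : ℕ) (t : ℝ) :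
    ∫ u, Complex.exp (t * u * Complex.I) ∂erlang k = ((1 - t * Complex.I)⁻¹) ^ (k + 1) := by
  have h1 := one_sub_ofReal_mul_I_ne_zero t
  rw [erlang, integral_withDensity_eq_integral_toReal_smul (by fun_prop) (by simp)]
  have key : ∀ u ∈ Set.Ioi (0 : ℝ),
      (ENNReal.ofReal (u ^ k / (k.factorial : ℝ) * Real.exp (-u))).toReal •
        Complex.exp (t * u * Complex.I) =
      (1 / (k.factorial : ℂ)) * ((u : ℂ) ^ k * Complex.exp (-(1 - t * Complex.I) * u)) := by
    intro u hu
    have hu' : (0 : ℝ) < u := hu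
    rw [ENNReal.toReal_ofReal (by positivity), Complex.real_smul,
      show -(1 - t * Complex.I) * (u : ℂ) = -u + t * u * Complex.I by ring, Complex.exp_add]
    push_cast
    ring
  rw [setIntegral_congr_fun measurableSet_Ioi key, integral_const_mul,
    integral_pow_mul_cexp (by simp)]
  have : (k.factorial : ℂ) ≠ 0 := by exact_mod_cast k.factorial_ne_zero
  rw [inv_pow]
  field_simp

/-- The total mass is the characteristic function at `t = 0`. -/
lemma isProbabilityMeasure_erlang (k : ℕ) : IsProbabilityMeasure (erlang k) := by
  have hint : Integrable (fun u : ℝ => u ^ k / (k.factorial : ℝ) * Real.exp (-u))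
      (volume.restrict (Set.Ioi 0)) := by
    have h := (integrableOn_pow_mul_cexp (z := 1) (by simp) k).norm.div_const (k.factorial : ℝ)
    refine h.congr ?_
    filter_upwards [ae_restrict_mem measurableSet_Ioi] with u hu
    have hu' : (0 : ℝ) < u := hu
    rw [norm_mul, norm_pow, Complex.norm_exp]
    simp [abs_of_pos hu']
    ring
  have hfin : IsFiniteMeasure (erlang k) := by
    constructor
    rw [erlang, withDensity_apply _ MeasurableSet.univ, Measure.restrict_univ]
    exact hint.lintegral_lt_top
  have h := integral_cexp_erlang k 0
  simp at h
  constructor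
  rw [← ENNReal.ofReal_toReal (measure_ne_top (erlang k) Set.univ)]
  have : (erlang k).real Set.univ = 1 := by exact_mod_cast h
  rw [measureReal_def] at this
  simp [this]

/-- The Poisson mixture of standard gamma laws with shapes `N, N + 1, …`: the law of half a
noncentral chi-square variable with `2 N` degrees of freedom and noncentrality `2 l`. -/
noncomputable def noncentralGamma (N : ℕ) (l : ℝ) : Measure ℝ :=
  Measure.sum fun i : ℕ =>
    ENNReal.ofReal (Real.exp (-l) * l ^ i / (i.factorial : ℝ)) • erlang (N - 1 + i)

lemma isProbabilityMeasure_noncentralGamma (N : ℕ) {l : ℝ} (hl : 0 ≤ l) :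
    IsProbabilityMeasure (noncentralGamma N l) := by
  constructor
  have h := hasSum_one_poissonMeasure ⟨l, hl⟩
  change HasSum (fun i : ℕ => Real.exp (-l) * l ^ i / (i.factorial : ℝ)) 1 at h
  rw [noncentralGamma, Measure.sum_apply _ MeasurableSet.univ]
  have := isProbabilityMeasure_erlang
  simp only [Measure.smul_apply, measure_univ, smul_eq_mul, mul_one]
  rw [← ENNReal.ofReal_tsum_of_nonneg (fun i => by positivity) h.summable, h.tsum_eq]
  simp

/-- With `r = (1 - t i)⁻¹`, the component of index `i` contributes `r ^ (N + i)`, and the Poisson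
weights sum these to `r ^ N exp (l (r - 1))`. The hypothesis `1 ≤ N` makes the truncated shape index
`N - 1 + i` correct. -/
lemma integral_cexp_noncentralGamma {N : ℕ} (hN : 1 ≤ N) {l : ℝ} (hl : 0 ≤ l) (t : ℝ) :
    ∫ u, Complex.exp (t * u * Complex.I) ∂noncentralGamma N l =
      ((1 - t * Complex.I)⁻¹) ^ N * Complex.exp (l * ((1 - t * Complex.I)⁻¹ - 1)) := by
  have := isProbabilityMeasure_noncentralGamma N hl
  have hint : Integrable (fun u : ℝ => Complex.exp (t * u * Complex.I)) (noncentralGamma N l) := by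
    refine Integrable.of_bound (by fun_prop) 1 (ae_of_all _ fun u => ?_)
    rw [← Complex.ofReal_mul, Complex.norm_exp_ofReal_mul_I]
  have hs := hasSum_integral_measure hint
  refine hs.unique ?_
  have he := (NormedSpace.expSeries_div_hasSum_exp (𝔸 := ℂ) (l * (1 - t * Complex.I)⁻¹)).mul_left
    (Complex.exp (-l) * ((1 - t * Complex.I)⁻¹) ^ N)
  rw [← Complex.exp_eq_exp_ℂ] at he
  convert! he using 1
  · ext i
    rw [integral_smul_measure, integral_cexp_erlang, ENNReal.toReal_ofReal (by positivity),
      Complex.real_smul, show N - 1 + i + 1 = N + i by omega, pow_add, mul_pow]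
    push_cast
    ring
  · rw [mul_sub_one, ← neg_add_eq_sub (l : ℂ), Complex.exp_add]
    ring

/-- The energy of `N` independent `CN(z n, v)` samples, normalized by `v`, has a noncentral gamma
law which depends on the means only through their total energy. -/
lemma map_sum_norm_add_sq {N : ℕ} (hN : 1 ≤ N) {v : ℝ} (hv : 0 < v) (z : Fin N → ℂ) :
    (Measure.pi fun _ : Fin N => complexGaussian v).map
        (fun w => (∑ n, ‖z n + w n‖ ^ 2) / v) =
      noncentralGamma N ((∑ n, ‖z n‖ ^ 2) / v) := by
  have hl : 0 ≤ (∑ n, ‖z n‖ ^ 2) / v := by positivity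
  have := isProbabilityMeasure_noncentralGamma N hl
  have := isProbabilityMeasure_complexGaussian v
  have hm : Measurable (fun w : Fin N → ℂ => (∑ n, ‖z n + w n‖ ^ 2) / v) := by fun_prop
  have := Measure.isProbabilityMeasure_map (μ := Measure.pi fun _ : Fin N => complexGaussian v)
    hm.aemeasurable
  -- Independence factors the characteristic function over the samples. Each factor is `r exp ((‖z
  -- n‖² / v) (r - 1))` with the same `r`, so the product sees only `∑ ‖z n‖²`.
  refine Measure.ext_of_charFun ?_
  ext t
  rw [charFun_apply_real, charFun_apply_real, integral_cexp_noncentralGamma hN hl,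
    integral_map hm.aemeasurable (by fun_prop)]
  have h1 : ∀ w : Fin N → ℂ,
      Complex.exp (t * ((∑ n, ‖z n + w n‖ ^ 2) / v : ℝ) * Complex.I) =
        ∏ n, Complex.exp (t * (‖z n + w n‖ ^ 2 / v : ℝ) * Complex.I) := by
    intro w
    rw [← Complex.exp_sum, Finset.sum_div]
    push_cast
    rw [Finset.mul_sum, Finset.sum_mul]
  simp_rw [h1]
  rw [integral_fintype_prod_eq_prod
    (f := fun n w => Complex.exp (t * (‖z n + w‖ ^ 2 / v : ℝ) * Complex.I))]
  simp_rw [integral_cexp_norm_add_sq_complexGaussian hv]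
  rw [Finset.prod_mul_distrib, ← Complex.exp_sum, ← Finset.sum_mul, Finset.sum_div]
  simp

-- The Marcum Q-function as a noncentral gamma tail

/-- The substitution `u = v² / 2` brings in the integration variable of the Marcum Q-function. It is
injective on `(b, ∞)` because `0 ≤ b`. -/
lemma erlang_Ici {b : ℝ} (hb : 0 ≤ b) (k : ℕ) :
    erlang k (Set.Ici (b ^ 2 / 2)) = ∫⁻ v in Set.Ioi b, ENNReal.ofReal
      (v * ((v ^ 2 / 2) ^ k / (k.factorial : ℝ) * Real.exp (-(v ^ 2 / 2)))) := by
  have himg : (fun v : ℝ => v ^ 2 / 2) '' Set.Ioi b = Set.Ioi (b ^ 2 / 2) := by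
    ext u
    simp only [Set.mem_image, Set.mem_Ioi]
    constructor
    · rintro ⟨v, hv, rfl⟩
      nlinarith
    · intro hu
      have hu0 : 0 ≤ 2 * u := by nlinarith [sq_nonneg b]
      refine ⟨Real.sqrt (2 * u), ?_, ?_⟩
      · exact Real.lt_sqrt_of_sq_lt (by linarith)
      · rw [Real.sq_sqrt hu0]; ring
  have hinj : Set.InjOn (fun v : ℝ => v ^ 2 / 2) (Set.Ioi b) := by
    intro x hx y hy hxy
    have hx' : 0 < x := hb.trans_lt hx
    have hy' : 0 < y := hb.trans_lt hy
    have : x ^ 2 = y ^ 2 := by simpa using hxy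
    exact (pow_left_inj₀ hx'.le hy'.le two_ne_zero).1 this
  have hae : (Set.Ici (b ^ 2 / 2) ∩ Set.Ioi 0 : Set ℝ) =ᵐ[volume] Set.Ioi (b ^ 2 / 2) := by
    have h1 : (Set.Ici (b ^ 2 / 2) ∩ Set.Ioi 0 : Set ℝ) =ᵐ[volume]
        (Set.Ioi (b ^ 2 / 2) ∩ Set.Ioi 0 : Set ℝ) := Ioi_ae_eq_Ici.symm.inter (ae_eq_refl _)
    rw [Set.inter_eq_left.2 (Set.Ioi_subset_Ioi (by positivity))] at h1
    exact h1
  rw [erlang, withDensity_apply _ measurableSet_Ici, Measure.restrict_restrict measurableSet_Ici,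
    Measure.restrict_congr_set hae, ← himg,
    lintegral_image_eq_lintegral_abs_deriv_mul (f' := fun v => v) measurableSet_Ioi _ hinj]
  · refine setLIntegral_congr_fun measurableSet_Ioi fun v hv => ?_
    have hv' : 0 < v := hb.trans_lt hv
    rw [← ENNReal.ofReal_mul (abs_nonneg _), abs_of_pos hv']
  · intro x _
    have := ((hasDerivAt_id x).pow 2).div_const 2
    refine HasDerivAt.hasDerivWithinAt ?_
    convert! this using 1
    simp

lemma summable_besselI (n : ℕ) {z : ℝ} (hz : 0 ≤ z) :
    Summable fun i : ℕ => z ^ i / ((i.factorial : ℝ) * ((n + i).factorial : ℝ)) := by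
  refine Summable.of_nonneg_of_le (fun i => by positivity) (fun i => ?_)
    (Real.summable_pow_div_factorial z)
  gcongr
  have : (1 : ℝ) ≤ ((n + i).factorial : ℝ) := by exact_mod_cast (n + i).factorial_pos
  have h2 : (0 : ℝ) < (i.factorial : ℝ) := by exact_mod_cast i.factorial_pos
  nlinarith

lemma noncentralGamma_apply (N : ℕ) (l : ℝ) {s : Set ℝ} (hs : MeasurableSet s) :
    noncentralGamma N l s = ∑' i : ℕ,
      ENNReal.ofReal (Real.exp (-l) * l ^ i / (i.factorial : ℝ)) * erlang (N - 1 + i) s := by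
  simp [noncentralGamma, Measure.sum_apply _ hs]

/-- The generalized Marcum Q-function is the tail of the noncentral gamma law. -/
lemma marcumQ_eq_noncentralGamma (N : ℕ) {a b : ℝ} (ha : 0 < a) (hb : 0 ≤ b) (hN : 1 ≤ N) :
    marcumQ N a b = (noncentralGamma N (a ^ 2 / 2)).real (Set.Ici (b ^ 2 / 2)) := by
  -- `φ i` is a Poisson weight times a gamma density in the variable `v`. By `hterm` it is also the
  -- `i`-th term of the Bessel series in the Marcum integrand.
  set φ : ℕ → ℝ → ℝ := fun i v => Real.exp (-(a ^ 2 / 2)) * (a ^ 2 / 2) ^ i / (i.factorial : ℝ) *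
    (v * ((v ^ 2 / 2) ^ (N - 1 + i) / ((N - 1 + i).factorial : ℝ) * Real.exp (-(v ^ 2 / 2))))
    with hφ
  have hterm : ∀ i v, φ i v = (v ^ N * Real.exp (-(v ^ 2 + a ^ 2) / 2) *
      (a * v / 2) ^ (N - 1) / a ^ (N - 1)) *
        (((a * v) ^ 2 / 4) ^ i / ((i.factorial : ℝ) * ((N - 1 + i).factorial : ℝ))) := by
    intro i v
    have he : Real.exp (-(v ^ 2 + a ^ 2) / 2) =
        Real.exp (-(a ^ 2 / 2)) * Real.exp (-(v ^ 2 / 2)) := by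
      rw [← Real.exp_add]; congr 1; ring
    have h4 : (a * v) ^ 2 / 4 = a ^ 2 / 2 * (v ^ 2 / 2) := by ring
    have hv : v ^ N * (a * v / 2) ^ (N - 1) / a ^ (N - 1) = v * (v ^ 2 / 2) ^ (N - 1) := by
      obtain ⟨M, rfl⟩ : ∃ M, N = M + 1 := ⟨N - 1, by omega⟩
      simp only [Nat.add_sub_cancel]
      rw [div_pow, mul_pow, div_pow, ← pow_mul, pow_mul']
      field_simp
      ring
    rw [show v ^ N * Real.exp (-(v ^ 2 + a ^ 2) / 2) * (a * v / 2) ^ (N - 1) / a ^ (N - 1) =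
      (v ^ N * (a * v / 2) ^ (N - 1) / a ^ (N - 1)) * Real.exp (-(v ^ 2 + a ^ 2) / 2) by ring,
      hv, he, h4, mul_pow, hφ]
    simp only [pow_add]
    ring
  have hnn : ∀ i, ∀ v : ℝ, 0 < v → 0 ≤ φ i v := fun i v hv => by positivity
  have hsum : ∀ v, Summable fun i => φ i v := fun v => by
    simp_rw [hterm]
    exact (summable_besselI (N - 1) (by positivity)).mul_left _
  have htail : noncentralGamma N (a ^ 2 / 2) (Set.Ici (b ^ 2 / 2)) =
      ∫⁻ v in Set.Ioi b, ∑' i, ENNReal.ofReal (φ i v) := by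
    rw [noncentralGamma_apply _ _ measurableSet_Ici, lintegral_tsum fun i => by fun_prop]
    refine tsum_congr fun i => ?_
    rw [erlang_Ici hb, ← lintegral_const_mul _ (by fun_prop)]
    refine setLIntegral_congr_fun measurableSet_Ioi fun v _ => ?_
    rw [← ENNReal.ofReal_mul (by positivity)]
  have hfin : ∀ v ∈ Set.Ioi b, ∑' i, ENNReal.ofReal (φ i v) =
      ENNReal.ofReal (∑' i, φ i v) := fun v hv =>
    (ENNReal.ofReal_tsum_of_nonneg (fun i => hnn i v (hb.trans_lt hv)) (hsum v)).symm
  rw [measureReal_def, htail, ← integral_toReal, marcumQ, ← integral_const_mul]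
  · refine setIntegral_congr_fun measurableSet_Ioi fun v hv => ?_
    have hv' : 0 < v := hb.trans_lt hv
    rw [hfin v hv, ENNReal.toReal_ofReal (tsum_nonneg fun i => hnn i v hv')]
    simp_rw [hterm]
    rw [tsum_mul_left, besselI]
    ring
  · exact (Measurable.tsum fun i => by fun_prop).aemeasurable
  · filter_upwards [ae_restrict_mem measurableSet_Ioi] with v hv
    rw [hfin v hv]
    exact ENNReal.ofReal_lt_top

/-- Each gamma tail is antitone in the threshold, hence measurable; the weights are explicit in `l`.
-/
lemma measurable_noncentralGamma_Ici (N : ℕ) :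
    Measurable fun p : ℝ × ℝ => noncentralGamma N p.1 (Set.Ici p.2) := by
  simp_rw [noncentralGamma_apply N _ measurableSet_Ici]
  refine Measurable.tsum fun i => Measurable.mul (by fun_prop) ?_
  have h : Antitone fun c : ℝ => erlang (N - 1 + i) (Set.Ici c) := fun x y hxy =>
    measure_mono (Set.Ici_subset_Ici.2 hxy)
  exact h.measurable.comp measurable_snd

/-- Probability that the energy received from a source of energy `E` through a link of squared gain
`s` is at least `t`. -/
noncomputable def energyTail (N : ℕ) (E σ s t : ℝ) : ℝ :=
  (noncentralGamma N (N * (s * E / σ ^ 2))).real (Set.Ici (N * (t / σ ^ 2)))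

/-- Positivity of `s` matters: `marcumQ` divides by `a ^ (N - 1)`, so at `a = 0` it need not be a
tail probability. By contrast `energyTail` is meaningful for every `s ≥ 0`. -/
lemma tailQ_eq_energyTail {N : ℕ} (hN : 1 ≤ N) {E σ s t : ℝ} (hE : 0 < E) (hσ : 0 < σ)
    (hs : 0 < s) (ht : 0 ≤ t) : tailQ N E σ s t = energyTail N E σ s t := by
  have hN' : (0 : ℝ) < N := by exact_mod_cast hN
  rw [tailQ, energyTail, marcumQ_eq_noncentralGamma N (by positivity) (by positivity) hN,
    Real.sq_sqrt (by positivity), Real.sq_sqrt (by positivity)]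
  congr 2 <;> ring

lemma energyTail_nonneg (N : ℕ) (E σ s t : ℝ) : 0 ≤ energyTail N E σ s t := measureReal_nonneg

lemma energyTail_le_one (N : ℕ) {E s : ℝ} (hE : 0 ≤ E) (hs : 0 ≤ s) (σ t : ℝ) :
    energyTail N E σ s t ≤ 1 := by
  have := isProbabilityMeasure_noncentralGamma N (l := N * (s * E / σ ^ 2)) (by positivity)
  exact measureReal_le_one

lemma measurable_energyTail (N : ℕ) (E σ : ℝ) :
    Measurable fun p : ℝ × ℝ => energyTail N E σ p.1 p.2 := by
  have h : Measurable fun p : ℝ × ℝ => ((N * (p.1 * E / σ ^ 2), N * (p.2 / σ ^ 2)) : ℝ × ℝ) := by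
    fun_prop
  exact ((measurable_noncentralGamma_Ici N).comp h).ennreal_toReal

/-- The law of the energy received in one symbol period, given the gain and the signal. -/
lemma complexGaussian_energy_ge {N : ℕ} (hN : 1 ≤ N) {E σ : ℝ} (hσ : 0 < σ) (g : ℂ)
    {x : Fin N → ℂ} (hx : (1 / (N : ℝ)) * ∑ n, ‖x n‖ ^ 2 = E) (t : ℝ) :
    (Measure.pi fun _ : Fin N => complexGaussian (σ ^ 2)).real
      {w | t ≤ (1 / (N : ℝ)) * ∑ n, ‖g * x n + w n‖ ^ 2} = energyTail N E σ (‖g‖ ^ 2) t := by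
  have hN' : (0 : ℝ) < N := by exact_mod_cast hN
  have h := map_sum_norm_add_sq hN (v := σ ^ 2) (by positivity) fun n => g * x n
  have hl : (∑ n, ‖g * x n‖ ^ 2) / σ ^ 2 = N * (‖g‖ ^ 2 * E / σ ^ 2) := by
    simp_rw [norm_mul, mul_pow]
    rw [← Finset.mul_sum, ← hx]
    field_simp
  rw [hl] at h
  rw [energyTail, ← h, map_measureReal_apply (by fun_prop) measurableSet_Ici]
  congr 1
  ext w
  simp only [Set.mem_ofPred_eq, Set.mem_preimage, Set.mem_Ici]
  rw [le_div_iff₀ (by positivity), one_div_mul_eq_div, le_div_iff₀ hN']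
  have : (N : ℝ) * (t / σ ^ 2) * σ ^ 2 = t * N := by field_simp
  rw [this]

-- Changes of variables on the complex plane

/-- The determinant of multiplication by `c`, as a real linear map, is the field norm `‖c‖ ^ 2`. -/
lemma lintegral_complex_mul_left {c : ℂ} (hc : c ≠ 0) {f : ℂ → ℝ≥0∞} (hf : Measurable f) :
    ∫⁻ z, f (c * z) = ENNReal.ofReal (1 / ‖c‖ ^ 2) * ∫⁻ z, f z := by
  have hdet : LinearMap.det (LinearMap.mul ℝ ℂ c) = ‖c‖ ^ 2 := by
    have := Algebra.norm_complex_apply c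
    rw [Algebra.norm_apply] at this
    rw [← Complex.normSq_eq_norm_sq, ← this]
    rfl
  have hpos : 0 < ‖c‖ ^ 2 := by positivity
  have h := Measure.map_linearMap_addHaar_eq_smul_addHaar (volume : Measure ℂ)
    (f := LinearMap.mul ℝ ℂ c) (by rw [hdet]; exact hpos.ne')
  have h2 : ∫⁻ z, f z ∂(Measure.map (LinearMap.mul ℝ ℂ c) volume) = ∫⁻ z, f (c * z) :=
    lintegral_map hf (show Measurable fun z : ℂ => c * z by fun_prop)
  rw [← h2, h, lintegral_smul_measure, hdet, abs_of_pos (by positivity), one_div, smul_eq_mul]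

/-- Integration on `ℂ` in the coordinates `(‖z‖², arg z)`, the angle running over `(0, 2π]`. -/
lemma lintegral_complex_sqrt_polar {H : ℂ → ℝ≥0∞} (hH : Measurable H) :
    ∫⁻ z, H z = ∫⁻ μ in Set.Ioi (0 : ℝ), ∫⁻ θ in Set.Ioc 0 (2 * Real.pi),
      ENNReal.ofReal (1 / 2) * H (Real.sqrt μ * Complex.exp (θ * Complex.I)) := by
  have himg : (fun r : ℝ => r ^ 2) '' Set.Ioi 0 = Set.Ioi 0 := by
    ext u
    simp only [Set.mem_image, Set.mem_Ioi]
    constructor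
    · rintro ⟨v, hv, rfl⟩
      positivity
    · intro hu
      exact ⟨Real.sqrt u, Real.sqrt_pos.2 hu, Real.sq_sqrt hu.le⟩
  have hinj : Set.InjOn (fun r : ℝ => r ^ 2) (Set.Ioi 0) := fun x hx y hy hxy =>
    (pow_left_inj₀ (le_of_lt hx) (le_of_lt hy) two_ne_zero).1 hxy
  -- The available polar coordinates have angle in `(-π, π)`. Reflecting `z` to `-z` turns the angle
  -- by `π`, which moves the range to `(0, 2π)`.
  rw [← lintegral_neg_eq_self, ← Complex.lintegral_comp_polarCoord_symm]
  simp_rw [Complex.polarCoord_symm_apply]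
  rw [polarCoord_target, Measure.volume_eq_prod, ← Measure.prod_restrict,
    lintegral_prod _ (by fun_prop)]
  -- Substitute `μ = r²` on the right: the factor `1 / 2` times the derivative `2 r` is the polar
  -- Jacobian `r`.
  nth_rewrite 2 [← himg]
  rw [lintegral_image_eq_lintegral_abs_deriv_mul (f' := fun r => 2 * r) measurableSet_Ioi _ hinj]
  · refine setLIntegral_congr_fun measurableSet_Ioi fun r hr => ?_
    have hr' : 0 < r := hr
    have hsh : ∀ G : ℝ → ℝ≥0∞, Measurable G → ∫⁻ θ in Set.Ioo (-Real.pi) Real.pi, G (θ + Real.pi) =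
        ∫⁻ θ in Set.Ioc 0 (2 * Real.pi), G θ := by
      intro G hG
      rw [← setLIntegral_congr (Ioo_ae_eq_Ioc (a := (0 : ℝ)) (b := 2 * Real.pi)),
        ← (measurePreserving_add_right volume Real.pi).setLIntegral_comp_preimage
          measurableSet_Ioo hG]
      congr 2
      ext θ
      simp only [Set.mem_preimage, Set.mem_Ioo]
      constructor <;> rintro ⟨h1, h2⟩ <;> constructor <;> linarith
    simp only
    rw [← hsh _ (by fun_prop), ← lintegral_const_mul _ (by fun_prop)]
    refine lintegral_congr fun θ => ?_
    rw [← mul_assoc, ← ENNReal.ofReal_mul (by positivity), Real.sqrt_sq hr'.le,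
      abs_of_pos (by positivity), smul_eq_mul]
    congr 2
    · ring
    · push_cast
      rw [add_mul, Complex.exp_add, Complex.exp_pi_mul_I, Complex.exp_mul_I]
      ring
  · intro x _
    have := (hasDerivAt_id x).pow 2
    refine HasDerivAt.hasDerivWithinAt ?_
    convert! this using 1
    simp

lemma lintegral_complex_norm_sq {F : ℝ → ℝ≥0∞} (hF : Measurable F) :
    ∫⁻ z : ℂ, F (‖z‖ ^ 2) = ENNReal.ofReal Real.pi * ∫⁻ x in Set.Ioi (0 : ℝ), F x := by
  rw [lintegral_complex_sqrt_polar (by fun_prop), ← lintegral_const_mul _ hF]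
  refine setLIntegral_congr_fun measurableSet_Ioi fun x hx => ?_
  have hx' : (0 : ℝ) < x := hx
  have : ∀ θ : ℝ, ‖(Real.sqrt x * Complex.exp (θ * Complex.I) : ℂ)‖ ^ 2 = x := fun θ => by
    rw [norm_mul, Complex.norm_exp_ofReal_mul_I, Complex.norm_real, mul_one, Real.norm_eq_abs,
      sq_abs, Real.sq_sqrt hx'.le]
  simp only [this, lintegral_const, Measure.restrict_apply_univ, Real.volume_Ioc, sub_zero]
  rw [mul_right_comm, ← ENNReal.ofReal_mul (by positivity)]
  congr 2
  ring

-- The Bessel function `K_0` and the law of the product channel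

lemma measurable_besselK0 : Measurable besselK0 := by
  have h : StronglyMeasurable fun p : ℝ × ℝ => Real.exp (-p.1 * Real.cosh p.2) :=
    (by fun_prop : Measurable fun p : ℝ × ℝ => Real.exp (-p.1 * Real.cosh p.2)).stronglyMeasurable
  exact (h.integral_prod_right' (ν := volume.restrict (Set.Ioi 0))).measurable

lemma besselK0_nonneg (z : ℝ) : 0 ≤ besselK0 z :=
  integral_nonneg fun _ => (Real.exp_pos _).le

lemma integrableOn_exp_neg_mul_cosh {z : ℝ} (hz : 0 < z) :
    IntegrableOn (fun t => Real.exp (-z * Real.cosh t)) (Set.Ioi 0) := by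
  refine Integrable.mono' (integrableOn_exp_mul_Ioi (neg_lt_zero.2 hz) 0) (by fun_prop) ?_
  filter_upwards [ae_restrict_mem measurableSet_Ioi] with t ht
  have ht' : (0 : ℝ) < t := ht
  rw [Real.norm_eq_abs, Real.abs_exp, Real.exp_le_exp]
  have h1 := Real.self_le_sinh_iff.2 ht'.le
  have h2 := Real.sinh_lt_cosh t
  nlinarith

/-- `cosh` is even, so the integral over the line is twice the one over the half-line. -/
lemma ofReal_besselK0 {z : ℝ} (hz : 0 < z) :
    2 * ENNReal.ofReal (besselK0 z) = ∫⁻ t, ENNReal.ofReal (Real.exp (-z * Real.cosh t)) := by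
  rw [besselK0, ofReal_integral_eq_lintegral_ofReal (integrableOn_exp_neg_mul_cosh hz)
    (ae_of_all _ fun _ => (Real.exp_pos _).le), ← lintegral_add_compl (μ := volume)
      (fun t => ENNReal.ofReal (Real.exp (-z * Real.cosh t))) (measurableSet_Ioi (a := 0)),
    Set.compl_Ioi, ← setLIntegral_congr Iio_ae_eq_Iic, two_mul]
  congr 1
  rw [← (Measure.measurePreserving_neg volume).setLIntegral_comp_preimage measurableSet_Iio
    (by fun_prop)]
  simp

/-- The change of variables `x = r exp t` in an integral defining `K_0`. -/
lemma lintegral_exp_neg_add_inv_div {r : ℝ} (hr : 0 < r) (s : ℝ) :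
    ∫⁻ x in Set.Ioi (0 : ℝ), ENNReal.ofReal (Real.exp (-x / s) * Real.exp (-(r ^ 2 / x) / s) / x) =
      ∫⁻ t, ENNReal.ofReal (Real.exp (-(2 * r / s) * Real.cosh t)) := by
  have himg : (fun t : ℝ => r * Real.exp t) '' Set.univ = Set.Ioi 0 := by
    ext u
    simp only [Set.mem_image, Set.mem_Ioi, Set.mem_univ, true_and]
    constructor
    · rintro ⟨v, rfl⟩
      positivity
    · intro hu
      refine ⟨Real.log (u / r), ?_⟩
      rw [Real.exp_log (by positivity)]
      field_simp
  have hinj : Set.InjOn (fun t : ℝ => r * Real.exp t) Set.univ := fun x _ y _ hxy =>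
    Real.exp_injective (mul_left_cancel₀ hr.ne' hxy)
  rw [← himg, lintegral_image_eq_lintegral_abs_deriv_mul (f' := fun t => r * Real.exp t)
    MeasurableSet.univ (fun t _ => ((Real.hasDerivAt_exp t).const_mul r).hasDerivWithinAt) hinj,
    setLIntegral_univ]
  refine lintegral_congr fun t => ?_
  -- The Jacobian `r exp t` cancels the denominator `x`, and `x + r² / x = 2 r cosh t`.
  rw [← ENNReal.ofReal_mul (abs_nonneg _), abs_of_pos (by positivity), ← Real.exp_add,
    mul_div_cancel₀ _ (by positivity)]
  congr 2
  rw [Real.cosh_eq, Real.exp_neg]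
  field_simp
  ring

/-- The density of `α h_b h_t` with respect to Lebesgue measure; `a` stands for `|α|`. -/
noncomputable def productDensity (a s : ℝ) (w : ℂ) : ℝ :=
  2 / (Real.pi * (a * s) ^ 2) * besselK0 (‖w‖ / (a * s / 2))

lemma measurable_productDensity (a s : ℝ) : Measurable (productDensity a s) :=
  (measurable_besselK0.comp (by fun_prop)).const_mul _

/-- The integrand depends on `u` only through `x = ‖u‖²`; after the angular integration it is the
`K_0` integral with `r = ‖z‖ / ‖α‖`. The condition `z ≠ 0` ensures `r > 0`. -/
lemma lintegral_density_mul_density_div {α : ℂ} (hα : α ≠ 0) {s : ℝ} (hs : 0 < s) {z : ℂ}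
    (hz : z ≠ 0) :
    ∫⁻ u, ENNReal.ofReal (complexGaussianDensity s u *
        (1 / ‖α * u‖ ^ 2 * complexGaussianDensity s (z / (α * u)))) =
      ENNReal.ofReal (productDensity ‖α‖ s z) := by
  have hα' : 0 < ‖α‖ := norm_pos_iff.2 hα
  have hz' : 0 < ‖z‖ := norm_pos_iff.2 hz
  have h1 : ∀ u : ℂ, complexGaussianDensity s u *
        (1 / ‖α * u‖ ^ 2 * complexGaussianDensity s (z / (α * u))) =
      1 / (Real.pi * (s * ‖α‖)) ^ 2 * (Real.exp (-(‖u‖ ^ 2) / s) *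
        Real.exp (-((‖z‖ / ‖α‖) ^ 2 / ‖u‖ ^ 2) / s) / ‖u‖ ^ 2) := by
    intro u
    simp only [complexGaussianDensity, norm_div, norm_mul]
    have : -(‖z‖ / (‖α‖ * ‖u‖)) ^ 2 / s = -((‖z‖ / ‖α‖) ^ 2 / ‖u‖ ^ 2) / s := by
      rw [div_pow, div_pow, mul_pow, div_div]
    rw [this]
    field_simp
  simp_rw [h1]
  simp_rw [ENNReal.ofReal_mul (show 0 ≤ 1 / (Real.pi * (s * ‖α‖)) ^ 2 by positivity)]
  rw [lintegral_const_mul _ (by fun_prop), lintegral_complex_norm_sq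
    (F := fun x => ENNReal.ofReal (Real.exp (-x / s) * Real.exp (-((‖z‖ / ‖α‖) ^ 2 / x) / s) / x))
    (by fun_prop), lintegral_exp_neg_add_inv_div (by positivity), ← ofReal_besselK0 (by positivity),
    productDensity, ← mul_assoc, ← mul_assoc, ← ENNReal.ofReal_mul (by positivity),
    show (2 : ℝ≥0∞) = ENNReal.ofReal 2 by simp, ← ENNReal.ofReal_mul (by positivity),
    ← ENNReal.ofReal_mul (by positivity)]
  congr 2
  · field_simp
  · congr 1; field_simp

/-- The law of `α h_b h_t`. -/
lemma lintegral_product_complexGaussian {α : ℂ} (hα : α ≠ 0) {s : ℝ} (hs : 0 < s)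
    {H : ℂ → ℝ≥0∞} (hH : Measurable H) :
    ∫⁻ ht, ∫⁻ hb, H (α * hb * ht) ∂complexGaussian s ∂complexGaussian s =
      ∫⁻ w, ENNReal.ofReal (productDensity ‖α‖ s w) * H w := by
  have hG := isProbabilityMeasure_complexGaussian s
  have hm : Measurable fun u => ∫⁻ w, H (α * w * u) ∂complexGaussian s :=
    Measurable.lintegral_prod_right' (f := fun p : ℂ × ℂ => H (α * p.2 * p.1)) (by fun_prop)
  rw [lintegral_complexGaussian hs hm]
  -- The origin is null, and elsewhere multiplication by `α * u` is an invertible change of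
  -- variables. The same fact later discards `z = 0`, where the `K_0` formula is not available.
  have hne : ∀ᵐ u : ℂ, u ≠ 0 := by
    simp [ae_iff]
  have h1 : ∀ᵐ u : ℂ, ENNReal.ofReal (complexGaussianDensity s u) *
        ∫⁻ w, H (α * w * u) ∂complexGaussian s =
      ∫⁻ z, ENNReal.ofReal (complexGaussianDensity s u *
        (1 / ‖α * u‖ ^ 2 * complexGaussianDensity s (z / (α * u)))) * H z := by
    filter_upwards [hne] with u hu
    have hc : α * u ≠ 0 := mul_ne_zero hα hu
    have h2 := lintegral_complex_mul_left hc
      (f := fun z => ENNReal.ofReal (complexGaussianDensity s (z / (α * u))) * H z) (by fun_prop)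
    simp_rw [mul_div_cancel_left₀ _ hc] at h2
    rw [lintegral_complexGaussian hs (by fun_prop)]
    simp_rw [mul_right_comm α _ u]
    rw [h2, ← mul_assoc, ← ENNReal.ofReal_mul (complexGaussianDensity_nonneg hs _),
      ← lintegral_const_mul _ (by fun_prop)]
    refine lintegral_congr fun z => ?_
    rw [← mul_assoc, ← ENNReal.ofReal_mul
      (mul_nonneg (complexGaussianDensity_nonneg hs _) (by positivity)), mul_assoc]
  rw [lintegral_congr_ae h1, lintegral_lintegral_swap (by fun_prop)]
  refine lintegral_congr_ae ?_
  filter_upwards [hne] with z hz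
  rw [lintegral_mul_const _ (by fun_prop), lintegral_density_mul_density_div hα hs hz]

-- The joint density of the squared gains

/-- The inner kernel of `jointDensity`. -/
noncomputable def angularKernel (a s μ ν θ₀ θ₁ : ℝ) : ℝ :=
  besselK0 (Real.sqrt (μ + ν - 2 * Real.sqrt (μ * ν) * Real.cos (θ₁ - θ₀)) / (a * s / 2))

lemma measurable_angularKernel (a s : ℝ) : Measurable fun q : ((ℝ × ℝ) × ℝ) × ℝ =>
    angularKernel a s q.1.1.1 q.1.1.2 q.1.2 q.2 :=
  measurable_besselK0.comp (by fun_prop)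

lemma measurable_lintegral_angularKernel (a s μ ν : ℝ) :
    Measurable fun θ₀ : ℝ => ∫⁻ θ₁ in Set.Ioc 0 (2 * Real.pi),
      ENNReal.ofReal (angularKernel a s μ ν θ₀ θ₁) :=
  Measurable.lintegral_prod_right' (f := fun p : ℝ × ℝ =>
    ENNReal.ofReal (angularKernel a s μ ν p.1 p.2))
    (Measurable.comp (measurable_angularKernel a s) (f := fun p : ℝ × ℝ => (((μ, ν), p.1), p.2))
      (by fun_prop)).ennreal_ofReal

/-- The angular average in `jointDensity` as an extended nonnegative number. -/
noncomputable def angularMass (a s μ ν : ℝ) : ℝ≥0∞ :=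
  ∫⁻ θ₀ in Set.Ioc 0 (2 * Real.pi), ∫⁻ θ₁ in Set.Ioc 0 (2 * Real.pi),
    ENNReal.ofReal (angularKernel a s μ ν θ₀ θ₁)

lemma measurable_angularMass (a s : ℝ) :
    Measurable fun p : ℝ × ℝ => angularMass a s p.1 p.2 :=
  ((measurable_angularKernel a s).ennreal_ofReal.lintegral_prod_right').lintegral_prod_right'

/-- The law of cosines, which produces the argument of `K_0` in `jointDensity`. -/
lemma norm_sqrt_mul_exp_sub {μ ν : ℝ} (hμ : 0 ≤ μ) (hν : 0 ≤ ν) (θ₀ θ₁ : ℝ) :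
    ‖(Real.sqrt ν * Complex.exp (θ₁ * Complex.I) -
      Real.sqrt μ * Complex.exp (θ₀ * Complex.I) : ℂ)‖ =
      Real.sqrt (μ + ν - 2 * Real.sqrt (μ * ν) * Real.cos (θ₁ - θ₀)) := by
  rw [← Real.sqrt_sq (norm_nonneg _), ← Complex.normSq_eq_norm_sq, Complex.normSq_apply]
  congr 1
  simp only [Complex.exp_mul_I, ← Complex.ofReal_cos, ← Complex.ofReal_sin, Complex.sub_re,
    Complex.sub_im, Complex.add_re, Complex.add_im,
    Complex.ofReal_re, Complex.ofReal_im, Complex.mul_re, Complex.mul_im, Complex.I_re,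
    Complex.I_im]
  rw [Real.cos_sub, Real.sqrt_mul hμ]
  have h1 := Real.sq_sqrt hμ
  have h2 := Real.sq_sqrt hν
  have h3 := Real.sin_sq_add_cos_sq θ₀
  have h4 := Real.sin_sq_add_cos_sq θ₁
  linear_combination (Real.sqrt μ) ^ 2 * h3 + (Real.sqrt ν) ^ 2 * h4 + h1 + h2

/-- The factor of `jointDensity` in front of the angular integral. -/
noncomputable def radialFactor (a s μ : ℝ) : ℝ :=
  1 / (Real.pi * s) * Real.exp (-μ / s) * (1 / (2 * Real.pi * (a * s) ^ 2))

/-- The two factors `1 / 2` are the Jacobians of the two coordinate changes to `(‖z‖², arg z)`. -/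
lemma density_mul_productDensity {a s : ℝ} {μ ν : ℝ} (hμ : 0 ≤ μ)
    (hν : 0 ≤ ν) (θ₀ θ₁ : ℝ) :
    1 / 2 * complexGaussianDensity s (Real.sqrt μ * Complex.exp (θ₀ * Complex.I)) *
      (1 / 2 * productDensity a s (Real.sqrt ν * Complex.exp (θ₁ * Complex.I) -
        Real.sqrt μ * Complex.exp (θ₀ * Complex.I))) =
      radialFactor a s μ * angularKernel a s μ ν θ₀ θ₁ := by
  rw [productDensity, norm_sqrt_mul_exp_sub hμ hν, complexGaussianDensity, norm_mul,
    Complex.norm_exp_ofReal_mul_I, Complex.norm_real, mul_one, Real.norm_eq_abs, sq_abs,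
    Real.sq_sqrt hμ, radialFactor, angularKernel]
  field_simp

lemma lintegral_polar_of_angle {a s : ℝ} (hs : 0 < s) {F : ℝ × ℝ → ℝ≥0∞} (hF : Measurable F)
    {μ : ℝ} (hμ' : 0 < μ) (θ₀ : ℝ) :
    ENNReal.ofReal (1 / 2) *
      (ENNReal.ofReal (complexGaussianDensity s (Real.sqrt μ * Complex.exp (θ₀ * Complex.I))) *
        ∫⁻ z, ENNReal.ofReal (productDensity a s
          (z - Real.sqrt μ * Complex.exp (θ₀ * Complex.I))) *
          F (‖(Real.sqrt μ * Complex.exp (θ₀ * Complex.I) : ℂ)‖ ^ 2, ‖z‖ ^ 2)) =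
      ∫⁻ ν in Set.Ioi 0, ENNReal.ofReal (radialFactor a s μ) * F (μ, ν) *
        ∫⁻ θ₁ in Set.Ioc 0 (2 * Real.pi), ENNReal.ofReal (angularKernel a s μ ν θ₀ θ₁) := by
  have hker := measurable_angularKernel a s
  have hk := measurable_productDensity a s
  have hk1 : ∀ ν, Measurable fun θ₁ => angularKernel a s μ ν θ₀ θ₁ := fun ν =>
    Measurable.comp hker (f := fun θ₁ => (((μ, ν), θ₀), θ₁)) (by fun_prop)
  have hnorm : ∀ x : ℝ, 0 < x → ∀ θ : ℝ,
      ‖(Real.sqrt x * Complex.exp (θ * Complex.I) : ℂ)‖ ^ 2 = x := fun x hx θ => by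
    rw [norm_mul, Complex.norm_exp_ofReal_mul_I, Complex.norm_real, mul_one, Real.norm_eq_abs,
      sq_abs, Real.sq_sqrt hx.le]
  rw [lintegral_complex_sqrt_polar (by fun_prop), ← mul_assoc,
    ← ENNReal.ofReal_mul (by positivity), ← lintegral_const_mul _
    (Measurable.lintegral_prod_right' (f := fun p : ℝ × ℝ => ENNReal.ofReal (1 / 2) *
      (ENNReal.ofReal (productDensity a s (Real.sqrt p.1 * Complex.exp (p.2 * Complex.I) -
        Real.sqrt μ * Complex.exp (θ₀ * Complex.I))) *
        F (‖(Real.sqrt μ * Complex.exp (θ₀ * Complex.I) : ℂ)‖ ^ 2,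
          ‖(Real.sqrt p.1 * Complex.exp (p.2 * Complex.I) : ℂ)‖ ^ 2))) (by fun_prop))]
  refine setLIntegral_congr_fun measurableSet_Ioi fun ν hν => ?_
  have hν' : (0 : ℝ) < ν := hν
  simp only [hnorm μ hμ', hnorm ν hν']
  rw [← lintegral_const_mul _ (by fun_prop), ← lintegral_const_mul _ (by fun_prop)]
  refine lintegral_congr fun θ₁ => ?_
  rw [mul_right_comm (ENNReal.ofReal _) (F _), ← ENNReal.ofReal_mul
    (by unfold radialFactor; positivity), ← density_mul_productDensity hμ'.le hν'.le,
    ENNReal.ofReal_mul (mul_nonneg (by positivity) (complexGaussianDensity_nonneg hs _)),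
    ENNReal.ofReal_mul (by positivity), ENNReal.ofReal_mul (p := 1 / 2) (by positivity)]
  ring

/-- Given `h_r`, the gain `h_1` has the product density translated by `h_r`. Polar coordinates for
`h_0`, then for `h_1`, and Tonelli to bring both angles inside, give `angularMass`. -/
lemma lintegral_fading_angularMass {α : ℂ} (hα : α ≠ 0) {s : ℝ} (hs : 0 < s)
    {F : ℝ × ℝ → ℝ≥0∞} (hF : Measurable F) :
    ∫⁻ hr, ∫⁻ ht, ∫⁻ hb, F (‖hr‖ ^ 2, ‖hr + α * hb * ht‖ ^ 2)
        ∂complexGaussian s ∂complexGaussian s ∂complexGaussian s =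
      ∫⁻ μ in Set.Ioi 0, ∫⁻ ν in Set.Ioi 0,
        ENNReal.ofReal (radialFactor ‖α‖ s μ) * angularMass ‖α‖ s μ ν * F (μ, ν) := by
  have hk := measurable_productDensity ‖α‖ s
  have h1 : ∀ hr : ℂ, ∫⁻ ht, ∫⁻ hb, F (‖hr‖ ^ 2, ‖hr + α * hb * ht‖ ^ 2)
        ∂complexGaussian s ∂complexGaussian s =
      ∫⁻ z, ENNReal.ofReal (productDensity ‖α‖ s (z - hr)) * F (‖hr‖ ^ 2, ‖z‖ ^ 2) := by
    intro hr
    rw [lintegral_product_complexGaussian hα hs (H := fun w => F (‖hr‖ ^ 2, ‖hr + w‖ ^ 2))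
      (by fun_prop), ← lintegral_sub_right_eq_self _ hr]
    simp
  simp_rw [h1]
  have hM : Measurable fun hr : ℂ => ∫⁻ z : ℂ, ENNReal.ofReal (productDensity ‖α‖ s (z - hr)) *
      F (‖hr‖ ^ 2, ‖z‖ ^ 2) := Measurable.lintegral_prod_right'
    (f := fun p : ℂ × ℂ => ENNReal.ofReal (productDensity ‖α‖ s (p.2 - p.1)) *
      F (‖p.1‖ ^ 2, ‖p.2‖ ^ 2)) (by fun_prop)
  rw [lintegral_complexGaussian hs hM, lintegral_complex_sqrt_polar
    (H := fun hr => ENNReal.ofReal (complexGaussianDensity s hr) * ∫⁻ z : ℂ,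
      ENNReal.ofReal (productDensity ‖α‖ s (z - hr)) * F (‖hr‖ ^ 2, ‖z‖ ^ 2))
    (Measurable.mul (by fun_prop) hM)]
  refine setLIntegral_congr_fun measurableSet_Ioi fun μ hμ => ?_
  have hμ' : (0 : ℝ) < μ := hμ
  have hker := measurable_angularKernel ‖α‖ s
  simp_rw [lintegral_polar_of_angle hs hF hμ']
  have hin : Measurable fun q : ℝ × ℝ =>
      ∫⁻ θ₁ in Set.Ioc 0 (2 * Real.pi), ENNReal.ofReal (angularKernel ‖α‖ s μ q.2 q.1 θ₁) :=
    Measurable.lintegral_prod_right' (f := fun p : (ℝ × ℝ) × ℝ =>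
      ENNReal.ofReal (angularKernel ‖α‖ s μ p.1.2 p.1.1 p.2))
      (Measurable.comp hker (f := fun p : (ℝ × ℝ) × ℝ => (((μ, p.1.2), p.1.1), p.2))
        (by fun_prop)).ennreal_ofReal
  have hsw : Measurable fun q : ℝ × ℝ => ENNReal.ofReal (radialFactor ‖α‖ s μ) * F (μ, q.2) *
      ∫⁻ θ₁ in Set.Ioc 0 (2 * Real.pi), ENNReal.ofReal (angularKernel ‖α‖ s μ q.2 q.1 θ₁) :=
    Measurable.mul (by fun_prop) hin
  rw [lintegral_lintegral_swap hsw.aemeasurable]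
  refine lintegral_congr fun ν => ?_
  rw [lintegral_const_mul _ (measurable_lintegral_angularKernel _ _ _ _), mul_right_comm, angularMass]

/-- Finiteness makes the inner angular integral finite for almost every `θ₀`, so passing to real
values commutes with the outer integration. -/
lemma jointDensity_eq_toReal {a σh μ ν : ℝ} (h : angularMass a (σh ^ 2) μ ν ≠ ∞) :
    jointDensity a σh μ ν = radialFactor a (σh ^ 2) μ * (angularMass a (σh ^ 2) μ ν).toReal := by
  have hker := measurable_angularKernel a (σh ^ 2)
  have hm := measurable_lintegral_angularKernel a (σh ^ 2) μ ν
  rw [jointDensity, radialFactor]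
  congr 1
  rw [angularMass, intervalIntegral.integral_of_le (by positivity),
    ← integral_toReal hm.aemeasurable (ae_lt_top hm h)]
  refine integral_congr_ae (ae_of_all _ fun θ₀ => ?_)
  simp only
  rw [intervalIntegral.integral_of_le (by positivity), integral_eq_lintegral_of_nonneg_ae
    (ae_of_all _ fun _ => besselK0_nonneg _)]
  · rfl
  · exact (Measurable.comp hker (f := fun θ₁ : ℝ => (((μ, ν), θ₀), θ₁))
      (by fun_prop)).aestronglyMeasurable

/-- The squared gains `(μ, ν)` have the density `jointDensity` on the open first quadrant. -/
lemma lintegral_fading {α : ℂ} (hα : α ≠ 0) {σh : ℝ} (hσh : 0 < σh)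
    {F : ℝ × ℝ → ℝ≥0∞} (hF : Measurable F) :
    ∫⁻ hr, ∫⁻ ht, ∫⁻ hb, F (‖hr‖ ^ 2, ‖hr + α * hb * ht‖ ^ 2)
        ∂complexGaussian (σh ^ 2) ∂complexGaussian (σh ^ 2) ∂complexGaussian (σh ^ 2) =
      ∫⁻ p in Set.Ioi 0 ×ˢ Set.Ioi 0, ENNReal.ofReal (jointDensity ‖α‖ σh p.1 p.2) * F p := by
  have hs : 0 < σh ^ 2 := by positivity
  have hα' : 0 < ‖α‖ := norm_pos_iff.2 hα
  have hmass := measurable_angularMass ‖α‖ (σh ^ 2)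
  have hrad : Measurable fun p : ℝ × ℝ => ENNReal.ofReal (radialFactor ‖α‖ (σh ^ 2) p.1) := by
    unfold radialFactor; fun_prop
  have key : ∀ G : ℝ × ℝ → ℝ≥0∞, Measurable G →
      ∫⁻ hr, ∫⁻ ht, ∫⁻ hb, G (‖hr‖ ^ 2, ‖hr + α * hb * ht‖ ^ 2)
        ∂complexGaussian (σh ^ 2) ∂complexGaussian (σh ^ 2) ∂complexGaussian (σh ^ 2) =
      ∫⁻ p in Set.Ioi 0 ×ˢ Set.Ioi 0, ENNReal.ofReal (radialFactor ‖α‖ (σh ^ 2) p.1) *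
        angularMass ‖α‖ (σh ^ 2) p.1 p.2 * G p := by
    intro G hG
    rw [lintegral_fading_angularMass hα hs hG, Measure.volume_eq_prod, ← Measure.prod_restrict,
      lintegral_prod (fun p : ℝ × ℝ => ENNReal.ofReal (radialFactor ‖α‖ (σh ^ 2) p.1) *
        angularMass ‖α‖ (σh ^ 2) p.1 p.2 * G p) ((hrad.mul hmass).mul hG).aemeasurable]
  -- Testing against the constant `1` shows that the extended density has total mass one. It is
  -- therefore finite almost everywhere, and there `jointDensity` is its real value.
  have hone := key (fun _ => 1) measurable_const
  have := isProbabilityMeasure_complexGaussian (σh ^ 2)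
  simp only [lintegral_const, measure_univ, mul_one] at hone
  have hfin := ae_lt_top (hrad.mul hmass) (ne_of_eq_of_ne hone.symm ENNReal.one_ne_top)
  rw [key F hF]
  refine lintegral_congr_ae ?_
  filter_upwards [hfin] with p hp
  have hpos : 0 < radialFactor ‖α‖ (σh ^ 2) p.1 := by unfold radialFactor; positivity
  have hne : angularMass ‖α‖ (σh ^ 2) p.1 p.2 ≠ ∞ := by
    intro h
    simp [h, ENNReal.mul_top, hpos] at hp
  rw [jointDensity_eq_toReal hne, ENNReal.ofReal_mul hpos.le, ENNReal.ofReal_toReal hne]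

lemma jointDensity_nonneg (a σh μ ν : ℝ) : 0 ≤ jointDensity a σh μ ν := by
  unfold jointDensity
  refine mul_nonneg (by positivity) (intervalIntegral.integral_nonneg (by positivity) fun θ₀ _ =>
    intervalIntegral.integral_nonneg (by positivity) fun θ₁ _ => besselK0_nonneg _)

lemma measurable_jointDensity (a σh : ℝ) :
    Measurable fun p : ℝ × ℝ => jointDensity a σh p.1 p.2 := by
  have h : StronglyMeasurable fun q : ((ℝ × ℝ) × ℝ) × ℝ =>
      angularKernel a (σh ^ 2) q.1.1.1 q.1.1.2 q.1.2 q.2 :=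
    (measurable_angularKernel a (σh ^ 2)).stronglyMeasurable
  have h2 := ((h.integral_prod_right' (ν := volume.restrict (Set.Ioc 0 (2 * Real.pi)))
    ).integral_prod_right' (ν := volume.restrict (Set.Ioc 0 (2 * Real.pi)))).measurable
  simp_rw [jointDensity, intervalIntegral.integral_of_le Real.two_pi_pos.le]
  exact Measurable.mul (by fun_prop) h2

-- Conditioning on fading, bits and signal

/-- The sample space of a link with `K` symbol periods of `N` samples. -/
abbrev LinkSpace (N K : ℕ) : Type :=
  ℂ × ℂ × ℂ × (Fin K → Bool) × (Fin K → Fin N → ℂ) × (Fin K → Fin N → ℂ)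

/-- The coordinate link on `LinkSpace N K`. -/
def coordinateLink (N K : ℕ) : Link (LinkSpace N K) N K where
  hr q := q.1
  ht q := q.2.1
  hb q := q.2.2.1
  src q := q.2.2.2.1
  x q := q.2.2.2.2.1
  w q := q.2.2.2.2.2

/-- The sample of a link as a point of `LinkSpace N K`. -/
def Link.sample {Ω : Type*} {N K : ℕ} (L : Link Ω N K) (ω : Ω) : LinkSpace N K :=
  (L.hr ω, L.ht ω, L.hb ω, L.src ω, L.x ω, L.w ω)

lemma isProbabilityMeasure_fairBit : IsProbabilityMeasure fairBit := by
  unfold fairBit; infer_instance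

lemma pi_fairBit_singleton (K : ℕ) (b : Fin K → Bool) :
    (Measure.pi fun _ : Fin K => fairBit) {b} = ENNReal.ofReal ((1 / 2) ^ K) := by
  have := isProbabilityMeasure_fairBit
  rw [Measure.pi_singleton]
  have h : ∀ c : Bool, fairBit {c} = ENNReal.ofReal (1 / 2) := fun c => by
    rw [fairBit, PMF.toMeasure_apply_singleton _ _ (measurableSet_singleton c)]
    simp [PMF.uniformOfFintype_apply]
  simp only [h, Finset.prod_const, Finset.card_univ, Fintype.card_fin]
  rw [ENNReal.ofReal_pow (by norm_num)]

/-- The probability of an event of a Rayleigh link, from its conditional probabilities given the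
fading components, the source bits and the ambient signal. -/
lemma Link.IsRayleigh.measure_sample {Ω : Type*} [MeasurableSpace Ω] {P : Measure Ω}
    [IsProbabilityMeasure P] {N K : ℕ} {L : Link Ω N K} {σh σ E : ℝ}
    (hL : L.IsRayleigh P σh σ E) (hσh : 0 < σh) {α : ℂ} (hα : α ≠ 0)
    {A : Set (LinkSpace N K)} (hA : MeasurableSet A) (Ψ : (Fin K → Bool) → ℝ × ℝ → ℝ)
    (hΨ : ∀ b, Measurable (Ψ b))
    (hcond : ∀ (hr ht hb : ℂ) (b : Fin K → Bool) (x : Fin K → Fin N → ℂ),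
      (∀ k, (1 / (N : ℝ)) * ∑ n, ‖x k n‖ ^ 2 = E) →
      (Measure.pi fun _ : Fin K => Measure.pi fun _ : Fin N => complexGaussian (σ ^ 2)).real
        {w | (hr, ht, hb, b, x, w) ∈ A} = Ψ b (‖hr‖ ^ 2, ‖hr + α * hb * ht‖ ^ 2)) :
    P (L.sample ⁻¹' A) = ∫⁻ p in Set.Ioi 0 ×ˢ Set.Ioi 0,
      ENNReal.ofReal (jointDensity ‖α‖ σh p.1 p.2) *
        ∑ b, ENNReal.ofReal ((1 / 2) ^ K) * ENNReal.ofReal (Ψ b p) := by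
  have := isProbabilityMeasure_fairBit
  have := fun v => isProbabilityMeasure_complexGaussian v
  have := Measure.isProbabilityMeasure_map (μ := P) hL.measurable_x.aemeasurable
  have hms : Measurable L.sample := hL.measurable_hr.prodMk (hL.measurable_ht.prodMk
    (hL.measurable_hb.prodMk (hL.measurable_src.prodMk
      (hL.measurable_x.prodMk hL.measurable_w))))
  -- The energy constraint holds only almost surely, so it is carried over to the law of `x`. On
  -- that event `hcond` gives a value independent of `x`, and integrating it over `x` changes
  -- nothing.
  have hx : ∀ᵐ x ∂P.map L.x, ∀ k, (1 / (N : ℝ)) * ∑ n, ‖x k n‖ ^ 2 = E := by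
    rw [ae_map_iff hL.measurable_x.aemeasurable]
    · exact hL.avg_energy
    · simp only [Set.ofPred_forall]
      exact MeasurableSet.iInter fun k => measurableSet_eq_fun (by fun_prop) (by fun_prop)
  have hlaw : P.map L.sample = _ := hL.joint_law
  rw [← Measure.map_apply hms hA, hlaw, Measure.prod_apply hA, ← lintegral_fading hα hσh
    (Finset.measurable_sum _ fun b _ => ((hΨ b).ennreal_ofReal.const_mul _))]
  refine lintegral_congr fun hr => ?_
  have hA1 := measurable_prodMk_left (x := hr) hA
  rw [Measure.prod_apply hA1]
  refine lintegral_congr fun ht => ?_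
  have hA2 := measurable_prodMk_left (x := ht) hA1
  rw [Measure.prod_apply hA2]
  refine lintegral_congr fun hb => ?_
  have hA3 := measurable_prodMk_left (x := hb) hA2
  rw [Measure.prod_apply hA3, lintegral_fintype]
  refine Finset.sum_congr rfl fun b _ => ?_
  have hA4 := measurable_prodMk_left (x := b) hA3
  rw [pi_fairBit_singleton, mul_comm, Measure.prod_apply hA4]
  congr 1
  have hc : ∀ᵐ x ∂P.map L.x,
      (Measure.pi fun _ : Fin K => Measure.pi fun _ : Fin N => complexGaussian (σ ^ 2))
        (Prod.mk x ⁻¹' (Prod.mk b ⁻¹' (Prod.mk hb ⁻¹' (Prod.mk ht ⁻¹' (Prod.mk hr ⁻¹' A))))) =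
      ENNReal.ofReal (Ψ b (‖hr‖ ^ 2, ‖hr + α * hb * ht‖ ^ 2)) := by
    filter_upwards [hx] with x hx
    rw [← hcond hr ht hb b x hx, measureReal_def, ENNReal.ofReal_toReal (measure_ne_top _ _)]
    rfl
  rw [lintegral_congr_ae hc]
  simp

/-- The probability of an event of a Rayleigh link as an integral against `jointDensity`. -/
lemma Link.IsRayleigh.measureReal_sample {Ω : Type*} [MeasurableSpace Ω] {P : Measure Ω}
    [IsProbabilityMeasure P] {N K : ℕ} {L : Link Ω N K} {σh σ E : ℝ}
    (hL : L.IsRayleigh P σh σ E) (hσh : 0 < σh) {α : ℂ} (hα : α ≠ 0)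
    {A : Set (LinkSpace N K)} (hA : MeasurableSet A) (Ψ : (Fin K → Bool) → ℝ × ℝ → ℝ)
    (hΨ : ∀ b, Measurable (Ψ b)) (hΨ0 : ∀ b, ∀ p : ℝ × ℝ, 0 ≤ p.1 → 0 ≤ p.2 → 0 ≤ Ψ b p)
    (hcond : ∀ (hr ht hb : ℂ) (b : Fin K → Bool) (x : Fin K → Fin N → ℂ),
      (∀ k, (1 / (N : ℝ)) * ∑ n, ‖x k n‖ ^ 2 = E) →
      (Measure.pi fun _ : Fin K => Measure.pi fun _ : Fin N => complexGaussian (σ ^ 2)).real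
        {w | (hr, ht, hb, b, x, w) ∈ A} = Ψ b (‖hr‖ ^ 2, ‖hr + α * hb * ht‖ ^ 2)) :
    IntegrableOn (fun p : ℝ × ℝ => jointDensity ‖α‖ σh p.1 p.2 * ((1 / 2) ^ K * ∑ b, Ψ b p))
        (Set.Ioi 0 ×ˢ Set.Ioi 0) ∧
      P.real (L.sample ⁻¹' A) = ∫ p in Set.Ioi 0 ×ˢ Set.Ioi 0,
        jointDensity ‖α‖ σh p.1 p.2 * ((1 / 2) ^ K * ∑ b, Ψ b p) := by
  have hQ : MeasurableSet (Set.Ioi (0 : ℝ) ×ˢ Set.Ioi (0 : ℝ)) :=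
    measurableSet_Ioi.prod measurableSet_Ioi
  have hmeas : Measurable fun p : ℝ × ℝ =>
      jointDensity ‖α‖ σh p.1 p.2 * ((1 / 2) ^ K * ∑ b, Ψ b p) :=
    (measurable_jointDensity _ _).mul ((Finset.measurable_sum _ fun b _ => hΨ b).const_mul _)
  have hnn : ∀ p ∈ Set.Ioi (0 : ℝ) ×ˢ Set.Ioi (0 : ℝ),
      0 ≤ jointDensity ‖α‖ σh p.1 p.2 * ((1 / 2) ^ K * ∑ b, Ψ b p) := fun p hp =>
    mul_nonneg (jointDensity_nonneg _ _ _ _) (mul_nonneg (by positivity)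
      (Finset.sum_nonneg fun b _ => hΨ0 b p (le_of_lt hp.1) (le_of_lt hp.2)))
  have hnn' := (ae_restrict_iff' (μ := volume) hQ).2 (ae_of_all _ hnn)
  have heq : P (L.sample ⁻¹' A) = ∫⁻ p in Set.Ioi 0 ×ˢ Set.Ioi 0,
      ENNReal.ofReal (jointDensity ‖α‖ σh p.1 p.2 * ((1 / 2) ^ K * ∑ b, Ψ b p)) := by
    rw [hL.measure_sample hσh hα hA Ψ hΨ hcond]
    refine setLIntegral_congr_fun hQ fun p hp => ?_
    rw [← Finset.mul_sum, ENNReal.ofReal_mul (jointDensity_nonneg _ _ _ _),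
      ENNReal.ofReal_mul (by positivity), ENNReal.ofReal_sum_of_nonneg fun b _ =>
        hΨ0 b p (le_of_lt hp.1) (le_of_lt hp.2)]
  -- The integrand is nonnegative and its lower integral is a probability, hence finite: this is
  -- integrability.
  refine ⟨⟨hmeas.aestronglyMeasurable, ?_⟩, ?_⟩
  · rw [hasFiniteIntegral_iff_ofReal hnn', ← heq]
    exact measure_lt_top _ _
  · rw [integral_eq_lintegral_of_nonneg_ae hnn' hmeas.aestronglyMeasurable, ← heq, measureReal_def]

lemma setIntegral_region {S : Set ℝ} {R : ℝ → Set ℝ} {D : Set (ℝ × ℝ)} (hS : MeasurableSet S)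
    (hD : MeasurableSet D) (hR : ∀ μ, MeasurableSet (R μ))
    (hmem : ∀ p : ℝ × ℝ, p ∈ D ↔ p.1 ∈ S ∧ p.2 ∈ R p.1) {h : ℝ × ℝ → ℝ} (hh : IntegrableOn h D) :
    ∫ p in D, h p = ∫ μ in S, ∫ ν in R μ, h (μ, ν) := by
  rw [← integral_indicator hD, Measure.volume_eq_prod, integral_prod, ← integral_indicator hS]
  · refine integral_congr_ae (ae_of_all _ fun μ => ?_)
    by_cases hμ : μ ∈ S
    · simp only [Set.indicator_of_mem hμ]
      rw [← integral_indicator (hR μ)]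
      refine integral_congr_ae (ae_of_all _ fun ν => ?_)
      by_cases hν : ν ∈ R μ
      · simp only [Set.indicator_of_mem hν]
        exact Set.indicator_of_mem ((hmem _).2 ⟨hμ, hν⟩) h
      · simp only [Set.indicator_of_notMem hν]
        exact Set.indicator_of_notMem (fun hc => hν ((hmem _).1 hc).2) h
    · simp only [Set.indicator_of_notMem hμ]
      rw [← integral_zero ℝ ℝ]
      refine integral_congr_ae (ae_of_all _ fun ν => ?_)
      exact Set.indicator_of_notMem (fun hc => hμ ((hmem _).1 hc).1) h
  · exact hh.integrable_indicator hD

-- Measurability of the error events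

section CoordinateLink

variable {N K : ℕ} (α : ℂ)

lemma measurable_coordinateLink_gain {c : LinkSpace N K → Bool} (hc : Measurable c) :
    Measurable fun q => (coordinateLink N K).gain α (c q) q := by
  have h : Measurable fun q => (if c q then 1 else 0 : ℂ) :=
    (measurable_of_countable fun b : Bool => (if b then 1 else 0 : ℂ)).comp hc
  simp only [Link.gain, coordinateLink]
  fun_prop

lemma measurable_coordinateLink_energy (k : Fin K) {c : LinkSpace N K → Bool}
    (hc : Measurable c) : Measurable fun q => (coordinateLink N K).energy α k (c q) q := by
  have h := measurable_coordinateLink_gain α hc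
  have hx : ∀ n, Measurable fun q => (coordinateLink N K).x q k n := fun n => by
    simp only [coordinateLink]; fun_prop
  have hw : ∀ n, Measurable fun q => (coordinateLink N K).w q k n := fun n => by
    simp only [coordinateLink]; fun_prop
  simp only [Link.energy]
  fun_prop

lemma measurable_coordinateLink_mu : Measurable fun q => (coordinateLink N K).mu α q :=
  (measurable_coordinateLink_gain α measurable_const).norm.pow_const 2

lemma measurable_coordinateLink_nu : Measurable fun q => (coordinateLink N K).nu α q :=
  (measurable_coordinateLink_gain α measurable_const).norm.pow_const 2

lemma measurable_coordinateLink_threshold {T : ℝ → ℝ → ℝ}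
    (hT : Measurable fun p : ℝ × ℝ => T p.1 p.2) :
    Measurable fun q => T ((coordinateLink N K).mu α q) ((coordinateLink N K).nu α q) :=
  hT.comp ((measurable_coordinateLink_mu α).prodMk (measurable_coordinateLink_nu α))

lemma measurable_coordinateLink_src (k : Fin K) :
    Measurable fun q => (coordinateLink N K).src q k := by
  simp only [coordinateLink]; fun_prop

end CoordinateLink

lemma measurable_detect {X : Type*} [MeasurableSpace X] {t y : X → ℝ} (ht : Measurable t)
    (hy : Measurable y) : Measurable fun q => detect (t q) (y q) := by
  refine measurable_to_bool ?_
  convert! measurableSet_le ht hy using 1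
  ext q
  simp [detect]

/-- Knowing which gain is larger only decides whether to negate the plain threshold detector, so
both receivers are governed by the same tail events. -/
lemma detectCSI_eq (μ ν t y : ℝ) :
    detectCSI μ ν t y = if ν < μ then !detect t y else detect t y := by
  unfold detectCSI detect
  split_ifs
  · by_cases h : y < t <;> simp [h, not_le.2, not_lt.1]
  · rfl

lemma measurable_detectCSI {X : Type*} [MeasurableSpace X] {μ ν t y : X → ℝ} (hμ : Measurable μ)
    (hν : Measurable ν) (ht : Measurable t) (hy : Measurable y) :
    Measurable fun q => detectCSI (μ q) (ν q) (t q) (y q) := by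
  simp_rw [detectCSI_eq]
  exact Measurable.ite (measurableSet_lt hν hμ)
    ((measurable_of_countable not).comp (measurable_detect ht hy)) (measurable_detect ht hy)

lemma measurableSet_errorCSI (N : ℕ) (α : ℂ) {T : ℝ → ℝ → ℝ}
    (hT : Measurable fun p : ℝ × ℝ => T p.1 p.2) :
    MeasurableSet {q | detectCSI ((coordinateLink N 1).mu α q) ((coordinateLink N 1).nu α q)
      (T ((coordinateLink N 1).mu α q) ((coordinateLink N 1).nu α q))
      ((coordinateLink N 1).energy α 0 ((coordinateLink N 1).src q 0) q) ≠
        (coordinateLink N 1).src q 0} :=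
  (measurableSet_eq_fun (measurable_detectCSI (measurable_coordinateLink_mu α)
    (measurable_coordinateLink_nu α) (measurable_coordinateLink_threshold α hT)
    (measurable_coordinateLink_energy α 0 (measurable_coordinateLink_src 0)))
    (measurable_coordinateLink_src 0)).compl

lemma measurable_xor {X : Type*} [MeasurableSpace X] {c d : X → Bool} (hc : Measurable c)
    (hd : Measurable d) : Measurable fun q => xor (c q) (d q) :=
  (measurable_of_countable fun p : Bool × Bool => xor p.1 p.2).comp (hc.prodMk hd)

lemma measurableSet_errorNoCSI (N : ℕ) (α : ℂ) {T : ℝ → ℝ → ℝ}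
    (hT : Measurable fun p : ℝ × ℝ => T p.1 p.2) :
    MeasurableSet {q | xor
      (detect (T ((coordinateLink N 2).mu α q) ((coordinateLink N 2).nu α q))
        ((coordinateLink N 2).energy α 1
          (xor ((coordinateLink N 2).src q 0) ((coordinateLink N 2).src q 1)) q))
      (detect (T ((coordinateLink N 2).mu α q) ((coordinateLink N 2).nu α q))
        ((coordinateLink N 2).energy α 0 ((coordinateLink N 2).src q 0) q)) ≠
        (coordinateLink N 2).src q 1} :=
  (measurableSet_eq_fun (measurable_xor
    (measurable_detect (measurable_coordinateLink_threshold α hT)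
      (measurable_coordinateLink_energy α 1
        (measurable_xor (measurable_coordinateLink_src 0) (measurable_coordinateLink_src 1))))
    (measurable_detect (measurable_coordinateLink_threshold α hT)
      (measurable_coordinateLink_energy α 0 (measurable_coordinateLink_src 0))))
    (measurable_coordinateLink_src 1)).compl

-- Conditional error probabilities and their average over the bits

/-- The tail probability at the threshold `T μ ν` when the bit `c` is sent. -/
noncomputable def bitTail (N : ℕ) (E σ : ℝ) (T : ℝ → ℝ → ℝ) (c : Bool) (p : ℝ × ℝ) : ℝ :=
  energyTail N E σ (if c then p.2 else p.1) (T p.1 p.2)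

lemma measurable_bitTail (N : ℕ) (E σ : ℝ) {T : ℝ → ℝ → ℝ}
    (hT : Measurable fun p : ℝ × ℝ => T p.1 p.2) (c : Bool) :
    Measurable (bitTail N E σ T c) := by
  have h : Measurable fun p : ℝ × ℝ => if c then p.2 else p.1 := by
    cases c
    · exact measurable_fst
    · exact measurable_snd
  exact Measurable.comp (g := fun p : ℝ × ℝ => energyTail N E σ p.1 p.2)
    (f := fun p : ℝ × ℝ => (if c then p.2 else p.1, T p.1 p.2)) (measurable_energyTail N E σ)
    (h.prodMk hT)

lemma bitTail_nonneg (N : ℕ) (E σ : ℝ) (T : ℝ → ℝ → ℝ) (c : Bool) (p : ℝ × ℝ) :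
    0 ≤ bitTail N E σ T c p := energyTail_nonneg _ _ _ _ _

lemma bitTail_le_one (N : ℕ) {E : ℝ} (hE : 0 ≤ E) (σ : ℝ) (T : ℝ → ℝ → ℝ) (c : Bool) {p : ℝ × ℝ}
    (h1 : 0 ≤ p.1) (h2 : 0 ≤ p.2) : bitTail N E σ T c p ≤ 1 :=
  energyTail_le_one N hE (by split_ifs <;> assumption) _ _

/-- The noise samples of one period for which the receiver sees at least the energy `t`. -/
def exceedSet {N : ℕ} (g : ℂ) (x : Fin N → ℂ) (t : ℝ) : Set (Fin N → ℂ) :=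
  {w | t ≤ (1 / (N : ℝ)) * ∑ n, ‖g * x n + w n‖ ^ 2}

lemma measurableSet_exceedSet {N : ℕ} (g : ℂ) (x : Fin N → ℂ) (t : ℝ) :
    MeasurableSet (exceedSet g x t) :=
  measurableSet_le measurable_const (by fun_prop)

lemma complexGaussian_exceedSet {N : ℕ} (hN : 1 ≤ N) {E σ : ℝ} (hσ : 0 < σ) (T : ℝ → ℝ → ℝ)
    (h0 h1 : ℂ) (c : Bool) {x : Fin N → ℂ} (hx : (1 / (N : ℝ)) * ∑ n, ‖x n‖ ^ 2 = E) :
    (Measure.pi fun _ : Fin N => complexGaussian (σ ^ 2)).real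
      (exceedSet (if c then h1 else h0) x (T (‖h0‖ ^ 2) (‖h1‖ ^ 2))) =
      bitTail N E σ T c (‖h0‖ ^ 2, ‖h1‖ ^ 2) := by
  rw [exceedSet, complexGaussian_energy_ge hN hσ _ hx, bitTail]
  cases c <;> simp

lemma coordinateLink_mu {N K : ℕ} (α hr ht hb : ℂ) (b : Fin K → Bool) (x w : Fin K → Fin N → ℂ) :
    (coordinateLink N K).mu α (hr, ht, hb, b, x, w) = ‖hr‖ ^ 2 := by
  simp [Link.mu, Link.gain, coordinateLink]

lemma coordinateLink_nu {N K : ℕ} (α hr ht hb : ℂ) (b : Fin K → Bool) (x w : Fin K → Fin N → ℂ) :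
    (coordinateLink N K).nu α (hr, ht, hb, b, x, w) = ‖hr + α * hb * ht‖ ^ 2 := by
  simp [Link.nu, Link.gain, coordinateLink]

lemma detect_coordinateLink_energy {N K : ℕ} (α hr ht hb : ℂ) (b : Fin K → Bool)
    (x w : Fin K → Fin N → ℂ) (t : ℝ) (k : Fin K) (c : Bool) :
    detect t ((coordinateLink N K).energy α k c (hr, ht, hb, b, x, w)) = true ↔
      w k ∈ exceedSet (if c then hr + α * hb * ht else hr) (x k) t := by
  cases c <;> simp [detect, Link.energy, Link.gain, coordinateLink, exceedSet]

/-- Conditional error probability of the receiver with CSI. -/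
noncomputable def condErrorCSI (N : ℕ) (E σ : ℝ) (T : ℝ → ℝ → ℝ) (b : Bool) (p : ℝ × ℝ) : ℝ :=
  if xor (decide (p.2 < p.1)) b then 1 - bitTail N E σ T b p else bitTail N E σ T b p

lemma measureReal_errorCSI {N : ℕ} (hN : 1 ≤ N) {E σ : ℝ} (hσ : 0 < σ) (T : ℝ → ℝ → ℝ)
    (α hr ht hb : ℂ) (b : Fin 1 → Bool) (x : Fin 1 → Fin N → ℂ)
    (hx : ∀ k, (1 / (N : ℝ)) * ∑ n, ‖x k n‖ ^ 2 = E) :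
    (Measure.pi fun _ : Fin 1 => Measure.pi fun _ : Fin N => complexGaussian (σ ^ 2)).real
      {w | (hr, ht, hb, b, x, w) ∈ {q : LinkSpace N 1 |
        detectCSI ((coordinateLink N 1).mu α q) ((coordinateLink N 1).nu α q)
          (T ((coordinateLink N 1).mu α q) ((coordinateLink N 1).nu α q))
          ((coordinateLink N 1).energy α 0 ((coordinateLink N 1).src q 0) q) ≠
        (coordinateLink N 1).src q 0}} =
      condErrorCSI N E σ T (b 0) (‖hr‖ ^ 2, ‖hr + α * hb * ht‖ ^ 2) := by
  have := isProbabilityMeasure_complexGaussian (σ ^ 2)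
  set h1 := hr + α * hb * ht with hh1
  set U := exceedSet (if b 0 then h1 else hr) (x 0) (T (‖hr‖ ^ 2) (‖h1‖ ^ 2)) with hU
  have hUm : MeasurableSet U := measurableSet_exceedSet _ _ _
  have hUr := complexGaussian_exceedSet hN hσ T hr h1 (b 0) (hx 0)
  have hev : ∀ S : Set (Fin N → ℂ), MeasurableSet S →
      (Measure.pi fun _ : Fin 1 => Measure.pi fun _ : Fin N => complexGaussian (σ ^ 2)).real
        {w | w 0 ∈ S} = (Measure.pi fun _ : Fin N => complexGaussian (σ ^ 2)).real S := by
    intro S hS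
    have hmp := measurePreserving_eval
      (fun _ : Fin 1 => Measure.pi fun _ : Fin N => complexGaussian (σ ^ 2)) 0
    exact hmp.measureReal_preimage hS.nullMeasurableSet
  have hset : {w | (hr, ht, hb, b, x, w) ∈ {q : LinkSpace N 1 |
        detectCSI ((coordinateLink N 1).mu α q) ((coordinateLink N 1).nu α q)
          (T ((coordinateLink N 1).mu α q) ((coordinateLink N 1).nu α q))
          ((coordinateLink N 1).energy α 0 ((coordinateLink N 1).src q 0) q) ≠
        (coordinateLink N 1).src q 0}} =
      {w | w 0 ∈ if xor (decide (‖h1‖ ^ 2 < ‖hr‖ ^ 2)) (b 0) then Uᶜ else U} := by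
    ext w
    have hd := detect_coordinateLink_energy α hr ht hb b x w (T (‖hr‖ ^ 2) (‖h1‖ ^ 2)) 0 (b 0)
    rw [← hh1, ← hU] at hd
    change detectCSI _ _ _ ((coordinateLink N 1).energy α 0 (b 0) (hr, ht, hb, b, x, w)) ≠ b 0 ↔ _
    rw [Set.mem_ofPred_eq, detectCSI_eq, coordinateLink_mu, coordinateLink_nu, ← hh1]
    -- Only the truth value of the detection matters now, so a finite case check remains.
    generalize detect _ _ = d at hd ⊢
    by_cases hlt : ‖h1‖ ^ 2 < ‖hr‖ ^ 2 <;>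
      rcases Bool.eq_false_or_eq_true (b 0) with hb0 | hb0 <;> simp [hlt, hb0, ← hd]
  rw [hset, condErrorCSI]
  split_ifs with hc
  · rw [hev _ hUm.compl, measureReal_compl hUm, hUr]
    simp
  · rw [hev _ hUm, hUr]

/-- Conditional error probability of the receiver without CSI. -/
noncomputable def condErrorNoCSI (N : ℕ) (E σ : ℝ) (T : ℝ → ℝ → ℝ) (b m : Bool) (p : ℝ × ℝ) : ℝ :=
  if m then 1 - (bitTail N E σ T (xor b m) p * (1 - bitTail N E σ T b p) +
    (1 - bitTail N E σ T (xor b m) p) * bitTail N E σ T b p)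
  else bitTail N E σ T (xor b m) p * (1 - bitTail N E σ T b p) +
    (1 - bitTail N E σ T (xor b m) p) * bitTail N E σ T b p

lemma pi_two_real_inter {X : Type*} [MeasurableSpace X] (V : Measure X) [IsProbabilityMeasure V]
    (A B : Set X) :
    (Measure.pi fun _ : Fin 2 => V).real {w | w 1 ∈ A ∧ w 0 ∈ B} = V.real A * V.real B := by
  have h : {w : Fin 2 → X | w 1 ∈ A ∧ w 0 ∈ B} = Set.univ.pi ![B, A] := by
    ext w
    simp [Set.mem_pi, Fin.forall_fin_two, and_comm]
  rw [h, measureReal_def, Measure.pi_pi, ENNReal.toReal_prod]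
  simp [Fin.prod_univ_two, measureReal_def, mul_comm]

lemma pi_two_real_xor {X : Type*} [MeasurableSpace X] (V : Measure X) [IsProbabilityMeasure V]
    {A B : Set X} (hA : MeasurableSet A) (hB : MeasurableSet B) :
    (Measure.pi fun _ : Fin 2 => V).real {w | Xor (w 1 ∈ A) (w 0 ∈ B)} =
      V.real A * (1 - V.real B) + (1 - V.real A) * V.real B := by
  have h : {w : Fin 2 → X | Xor (w 1 ∈ A) (w 0 ∈ B)} =
      {w | w 1 ∈ A ∧ w 0 ∈ Bᶜ} ∪ {w | w 1 ∈ Aᶜ ∧ w 0 ∈ B} := by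
    ext w
    simp only [Set.mem_ofPred_eq, Set.mem_union, Set.mem_compl_iff, Xor]
    tauto
  have hm : MeasurableSet {w : Fin 2 → X | w 1 ∈ Aᶜ ∧ w 0 ∈ B} :=
    (measurable_pi_apply (X := fun _ : Fin 2 => X) 1 hA.compl).inter
      (measurable_pi_apply (X := fun _ : Fin 2 => X) 0 hB)
  rw [h, measureReal_union _ hm, pi_two_real_inter, pi_two_real_inter, measureReal_compl hA,
    measureReal_compl hB]
  · simp
  · exact Set.disjoint_left.2 fun w hw hw' => hw'.1 hw.1

lemma measureReal_errorNoCSI {N : ℕ} (hN : 1 ≤ N) {E σ : ℝ} (hσ : 0 < σ) (T : ℝ → ℝ → ℝ)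
    (α hr ht hb : ℂ) (b : Fin 2 → Bool) (x : Fin 2 → Fin N → ℂ)
    (hx : ∀ k, (1 / (N : ℝ)) * ∑ n, ‖x k n‖ ^ 2 = E) :
    (Measure.pi fun _ : Fin 2 => Measure.pi fun _ : Fin N => complexGaussian (σ ^ 2)).real
      {w | (hr, ht, hb, b, x, w) ∈ {q : LinkSpace N 2 | xor
        (detect (T ((coordinateLink N 2).mu α q) ((coordinateLink N 2).nu α q))
          ((coordinateLink N 2).energy α 1
            (xor ((coordinateLink N 2).src q 0) ((coordinateLink N 2).src q 1)) q))
        (detect (T ((coordinateLink N 2).mu α q) ((coordinateLink N 2).nu α q))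
          ((coordinateLink N 2).energy α 0 ((coordinateLink N 2).src q 0) q)) ≠
        (coordinateLink N 2).src q 1}} =
      condErrorNoCSI N E σ T (b 0) (b 1) (‖hr‖ ^ 2, ‖hr + α * hb * ht‖ ^ 2) := by
  have := isProbabilityMeasure_complexGaussian (σ ^ 2)
  set h1 := hr + α * hb * ht with hh1
  set U : Bool → Fin 2 → Set (Fin N → ℂ) := fun c k =>
    exceedSet (if c then h1 else hr) (x k) (T (‖hr‖ ^ 2) (‖h1‖ ^ 2)) with hU
  have hUm : ∀ c k, MeasurableSet (U c k) := fun c k => measurableSet_exceedSet _ _ _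
  have hUr : ∀ c k, (Measure.pi fun _ : Fin N => complexGaussian (σ ^ 2)).real (U c k) =
      bitTail N E σ T c (‖hr‖ ^ 2, ‖h1‖ ^ 2) := fun c k =>
    complexGaussian_exceedSet hN hσ T hr h1 c (hx k)
  set X : Set (Fin 2 → Fin N → ℂ) := {w | Xor (w 1 ∈ U (xor (b 0) (b 1)) 1) (w 0 ∈ U (b 0) 0)}
    with hX
  have hXr := pi_two_real_xor (Measure.pi fun _ : Fin N => complexGaussian (σ ^ 2))
    (hUm (xor (b 0) (b 1)) 1) (hUm (b 0) 0)
  have hXm : MeasurableSet X := by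
    have hA := measurable_pi_apply (X := fun _ : Fin 2 => Fin N → ℂ) 1 (hUm (xor (b 0) (b 1)) 1)
    have hB := measurable_pi_apply (X := fun _ : Fin 2 => Fin N → ℂ) 0 (hUm (b 0) 0)
    exact (hA.diff hB).union (hB.diff hA)
  rw [← hX, hUr, hUr] at hXr
  have hset : {w | (hr, ht, hb, b, x, w) ∈ {q : LinkSpace N 2 | xor
        (detect (T ((coordinateLink N 2).mu α q) ((coordinateLink N 2).nu α q))
          ((coordinateLink N 2).energy α 1
            (xor ((coordinateLink N 2).src q 0) ((coordinateLink N 2).src q 1)) q))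
        (detect (T ((coordinateLink N 2).mu α q) ((coordinateLink N 2).nu α q))
          ((coordinateLink N 2).energy α 0 ((coordinateLink N 2).src q 0) q)) ≠
        (coordinateLink N 2).src q 1}} = if b 1 then Xᶜ else X := by
    ext w
    have hd := fun k c => detect_coordinateLink_energy α hr ht hb b x w
      (T (‖hr‖ ^ 2) (‖h1‖ ^ 2)) k c
    have hd0 : _ ↔ w 0 ∈ U (b 0) 0 := hd 0 (b 0)
    have hd1 : _ ↔ w 1 ∈ U (xor (b 0) (b 1)) 1 := hd 1 (xor (b 0) (b 1))
    have hwX : w ∈ X ↔ Xor (w 1 ∈ U (xor (b 0) (b 1)) 1) (w 0 ∈ U (b 0) 0) := Iff.rfl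
    rw [← hd0, ← hd1] at hwX
    change xor
      (detect _ ((coordinateLink N 2).energy α 1 (xor (b 0) (b 1)) (hr, ht, hb, b, x, w)))
      (detect _ ((coordinateLink N 2).energy α 0 (b 0) (hr, ht, hb, b, x, w))) ≠ b 1 ↔ _
    rw [coordinateLink_mu, coordinateLink_nu, ← hh1]
    clear_value X
    clear hd hd0 hd1
    generalize detect _ ((coordinateLink N 2).energy α 1 _ _) = d1 at hwX ⊢
    generalize detect _ _ = d0 at hwX ⊢
    by_cases hb1 : b 1 = true <;> cases d1 <;> cases d0 <;> simp_all [Xor]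
  rw [hset, condErrorNoCSI]
  split_ifs with hc
  · rw [measureReal_compl hXm, hXr]
    simp
  · rw [hXr]

lemma measurable_condErrorCSI (N : ℕ) (E σ : ℝ) {T : ℝ → ℝ → ℝ}
    (hT : Measurable fun p : ℝ × ℝ => T p.1 p.2) (b : Bool) :
    Measurable (condErrorCSI N E σ T b) := by
  have h := measurable_bitTail N E σ hT b
  have hlt : MeasurableSet {p : ℝ × ℝ | p.2 < p.1} := measurableSet_lt measurable_snd measurable_fst
  unfold condErrorCSI
  refine Measurable.ite ?_ (measurable_const.sub h) h
  cases b
  · simpa using hlt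
  · simpa using measurableSet_le (measurable_fst (α := ℝ) (β := ℝ)) measurable_snd

lemma condErrorCSI_nonneg (N : ℕ) {E : ℝ} (hE : 0 ≤ E) (σ : ℝ) (T : ℝ → ℝ → ℝ) (b : Bool)
    {p : ℝ × ℝ} (h1 : 0 ≤ p.1) (h2 : 0 ≤ p.2) : 0 ≤ condErrorCSI N E σ T b p := by
  unfold condErrorCSI
  split_ifs
  · exact sub_nonneg.2 (bitTail_le_one N hE σ T b h1 h2)
  · exact bitTail_nonneg _ _ _ _ _ _

lemma measurable_condErrorNoCSI (N : ℕ) (E σ : ℝ) {T : ℝ → ℝ → ℝ}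
    (hT : Measurable fun p : ℝ × ℝ => T p.1 p.2) (b m : Bool) :
    Measurable (condErrorNoCSI N E σ T b m) := by
  have h := measurable_bitTail N E σ hT
  have h1 : Measurable (bitTail N E σ T (xor b m)) := h _
  have h2 : Measurable (bitTail N E σ T b) := h _
  unfold condErrorNoCSI
  cases m
  · simp only [Bool.false_eq_true, if_false]
    exact (h1.mul (measurable_const.sub h2)).add ((measurable_const.sub h1).mul h2)
  · simp only [if_true]
    exact measurable_const.sub
      ((h1.mul (measurable_const.sub h2)).add ((measurable_const.sub h1).mul h2))

lemma condErrorNoCSI_nonneg (N : ℕ) {E : ℝ} (hE : 0 ≤ E) (σ : ℝ) (T : ℝ → ℝ → ℝ) (b m : Bool)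
    {p : ℝ × ℝ} (hp1 : 0 ≤ p.1) (hp2 : 0 ≤ p.2) : 0 ≤ condErrorNoCSI N E σ T b m p := by
  have h0 := bitTail_nonneg N E σ T b p
  have h1 := bitTail_nonneg N E σ T (xor b m) p
  have h0' := sub_nonneg.2 (bitTail_le_one N hE σ T b hp1 hp2)
  have h1' := sub_nonneg.2 (bitTail_le_one N hE σ T (xor b m) hp1 hp2)
  unfold condErrorNoCSI
  split_ifs
  -- For tails `u`, `v`, one minus the probability of differing detections is `u v + (1 - u) (1 -
  -- v)`.
  · nlinarith [mul_nonneg h0 h1, mul_nonneg h0' h1']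
  · positivity

lemma sum_condErrorCSI (N : ℕ) (E σ : ℝ) (T : ℝ → ℝ → ℝ) (p : ℝ × ℝ) :
    (1 / 2 : ℝ) ^ 1 * ∑ b : Fin 1 → Bool, condErrorCSI N E σ T (b 0) p =
      if p.2 < p.1 then 1 / 2 * (1 + bitTail N E σ T true p - bitTail N E σ T false p)
      else 1 / 2 * (1 + bitTail N E σ T false p - bitTail N E σ T true p) := by
  rw [← (Equiv.funUnique (Fin 1) Bool).symm.sum_comp]
  by_cases h : p.2 < p.1 <;> simp [condErrorCSI, h] <;> ring

/-- For `m = 0` both symbols share a tail `q`, with error `2 q (1 - q)`. For `m = 1` the tails are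
`q_μ` and `q_ν` in some order, and the error is the probability of equal detections. The average
over the four bit pairs completes the square. -/
lemma sum_condErrorNoCSI (N : ℕ) (E σ : ℝ) (T : ℝ → ℝ → ℝ) (p : ℝ × ℝ) :
    (1 / 2 : ℝ) ^ 2 * ∑ b : Fin 2 → Bool, condErrorNoCSI N E σ T (b 0) (b 1) p =
      1 / 2 - 1 / 2 * (bitTail N E σ T true p - bitTail N E σ T false p) ^ 2 := by
  rw [← (finTwoArrowEquiv Bool).symm.sum_comp, Fintype.sum_prod_type]
  simp [condErrorNoCSI]
  ring

end AmbientBackscatter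

-- The two error rates

theorem theorem1
    {Ω₁ Ω₂ : Type*} [MeasurableSpace Ω₁] [MeasurableSpace Ω₂]
    (P₁ : Measure Ω₁) [IsProbabilityMeasure P₁] (P₂ : Measure Ω₂) [IsProbabilityMeasure P₂]
    (N : ℕ) (hN : 1 ≤ N) (α : ℂ) (hα : α ≠ 0)
    (σh σ E : ℝ) (hσh : 0 < σh) (hσ : 0 < σ) (hE : 0 < E)
    (T : ℝ → ℝ → ℝ) (hT : Measurable fun p : ℝ × ℝ => T p.1 p.2)
    (hT0 : ∀ μ ν : ℝ, 0 < μ → 0 < ν → 0 ≤ T μ ν)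
    (L₁ : Link Ω₁ N 1) (hL₁ : L₁.IsRayleigh P₁ σh σ E)
    (L₂ : Link Ω₂ N 2) (hL₂ : L₂.IsRayleigh P₂ σh σ E) :
    -- receiver with CSI
    (IntegrableOn (fun p : ℝ × ℝ => jointDensity ‖α‖ σh p.1 p.2 *
          (1 / 2 * (1 + tailQ N E σ p.2 (T p.1 p.2) - tailQ N E σ p.1 (T p.1 p.2))))
        {p | 0 < p.1 ∧ 0 < p.2 ∧ p.2 < p.1} ∧
      IntegrableOn (fun p : ℝ × ℝ => jointDensity ‖α‖ σh p.1 p.2 *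
          (1 / 2 * (1 + tailQ N E σ p.1 (T p.1 p.2) - tailQ N E σ p.2 (T p.1 p.2))))
        {p | 0 < p.1 ∧ p.1 ≤ p.2} ∧
      berCSI L₁ P₁ α T =
        (∫ μ in Set.Ioi (0 : ℝ), ∫ ν in Set.Ioo (0 : ℝ) μ, jointDensity ‖α‖ σh μ ν *
          (1 / 2 * (1 + tailQ N E σ ν (T μ ν) - tailQ N E σ μ (T μ ν)))) +
        ∫ μ in Set.Ioi (0 : ℝ), ∫ ν in Set.Ici μ, jointDensity ‖α‖ σh μ ν *
          (1 / 2 * (1 + tailQ N E σ μ (T μ ν) - tailQ N E σ ν (T μ ν)))) ∧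
    -- receiver without CSI
    (IntegrableOn (fun p : ℝ × ℝ => jointDensity ‖α‖ σh p.1 p.2 *
          (1 / 2 - 1 / 2 * (tailQ N E σ p.2 (T p.1 p.2) - tailQ N E σ p.1 (T p.1 p.2)) ^ 2))
        {p | 0 < p.1 ∧ 0 < p.2} ∧
      berNoCSI L₂ P₂ α T =
        ∫ μ in Set.Ioi (0 : ℝ), ∫ ν in Set.Ioi (0 : ℝ), jointDensity ‖α‖ σh μ ν *
          (1 / 2 - 1 / 2 * (tailQ N E σ ν (T μ ν) - tailQ N E σ μ (T μ ν)) ^ 2)) := by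
  obtain ⟨hint₁, heq₁⟩ := hL₁.measureReal_sample hσh hα (measurableSet_errorCSI N α hT)
    (fun b => condErrorCSI N E σ T (b 0)) (fun b => measurable_condErrorCSI N E σ hT (b 0))
    (fun b p h1 h2 => condErrorCSI_nonneg N hE.le σ T (b 0) h1 h2)
    (fun hr ht hb b x hx => measureReal_errorCSI hN hσ T α hr ht hb b x hx)
  obtain ⟨hint₂, heq₂⟩ := hL₂.measureReal_sample hσh hα (measurableSet_errorNoCSI N α hT)
    (fun b => condErrorNoCSI N E σ T (b 0) (b 1))
    (fun b => measurable_condErrorNoCSI N E σ hT (b 0) (b 1))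
    (fun b p h1 h2 => condErrorNoCSI_nonneg N hE.le σ T (b 0) (b 1) h1 h2)
    (fun hr ht hb b x hx => measureReal_errorNoCSI hN hσ T α hr ht hb b x hx)
  simp_rw [sum_condErrorCSI] at hint₁ heq₁
  simp_rw [sum_condErrorNoCSI] at hint₂ heq₂
  -- Tails become Marcum functions only on the open quadrant, where the gains are positive and the
  -- threshold is known to be nonnegative.
  have htrue : ∀ p : ℝ × ℝ, 0 < p.1 → 0 < p.2 →
      bitTail N E σ T true p = tailQ N E σ p.2 (T p.1 p.2) := fun p h1 h2 =>
    (tailQ_eq_energyTail hN hE hσ h2 (hT0 _ _ h1 h2)).symm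
  have hfalse : ∀ p : ℝ × ℝ, 0 < p.1 → 0 < p.2 →
      bitTail N E σ T false p = tailQ N E σ p.1 (T p.1 p.2) := fun p h1 h2 =>
    (tailQ_eq_energyTail hN hE hσ h1 (hT0 _ _ h1 h2)).symm
  have hD₁ : MeasurableSet {p : ℝ × ℝ | 0 < p.1 ∧ 0 < p.2 ∧ p.2 < p.1} :=
    (measurableSet_lt measurable_const measurable_fst).inter
      ((measurableSet_lt measurable_const measurable_snd).inter
        (measurableSet_lt measurable_snd measurable_fst))
  have hD₂ : MeasurableSet {p : ℝ × ℝ | 0 < p.1 ∧ p.1 ≤ p.2} :=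
    (measurableSet_lt measurable_const measurable_fst).inter
      (measurableSet_le measurable_fst measurable_snd)
  -- The diagonal goes to the second region, matching the receiver's convention for `ν = μ`.
  have hunion : (Set.Ioi 0 ×ˢ Set.Ioi 0 : Set (ℝ × ℝ)) =
      {p | 0 < p.1 ∧ 0 < p.2 ∧ p.2 < p.1} ∪ {p | 0 < p.1 ∧ p.1 ≤ p.2} := by
    ext p
    simp only [Set.mem_prod, Set.mem_Ioi, Set.mem_union, Set.mem_ofPred_eq]
    constructor
    · rintro ⟨h1, h2⟩
      rcases lt_or_ge p.2 p.1 with h | h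
      · exact Or.inl ⟨h1, h2, h⟩
      · exact Or.inr ⟨h1, h⟩
    · rintro (⟨h1, h2, -⟩ | ⟨h1, h⟩)
      · exact ⟨h1, h2⟩
      · exact ⟨h1, h1.trans_le h⟩
  have hdisj : Disjoint {p : ℝ × ℝ | 0 < p.1 ∧ 0 < p.2 ∧ p.2 < p.1}
      {p : ℝ × ℝ | 0 < p.1 ∧ p.1 ≤ p.2} :=
    Set.disjoint_left.2 fun p h h' => not_lt.2 h'.2 h.2.2
  have hQ : (Set.Ioi 0 ×ˢ Set.Ioi 0 : Set (ℝ × ℝ)) = {p | 0 < p.1 ∧ 0 < p.2} := rfl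
  have hc₁ : ∀ p ∈ {p : ℝ × ℝ | 0 < p.1 ∧ 0 < p.2 ∧ p.2 < p.1},
      (jointDensity ‖α‖ σh p.1 p.2 * if p.2 < p.1 then
        1 / 2 * (1 + bitTail N E σ T true p - bitTail N E σ T false p)
        else 1 / 2 * (1 + bitTail N E σ T false p - bitTail N E σ T true p)) =
      jointDensity ‖α‖ σh p.1 p.2 *
        (1 / 2 * (1 + tailQ N E σ p.2 (T p.1 p.2) - tailQ N E σ p.1 (T p.1 p.2))) := by
    rintro p ⟨h1, h2, h⟩
    rw [if_pos h, htrue p h1 h2, hfalse p h1 h2]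
  have hc₂ : ∀ p ∈ {p : ℝ × ℝ | 0 < p.1 ∧ p.1 ≤ p.2},
      (jointDensity ‖α‖ σh p.1 p.2 * if p.2 < p.1 then
        1 / 2 * (1 + bitTail N E σ T true p - bitTail N E σ T false p)
        else 1 / 2 * (1 + bitTail N E σ T false p - bitTail N E σ T true p)) =
      jointDensity ‖α‖ σh p.1 p.2 *
        (1 / 2 * (1 + tailQ N E σ p.1 (T p.1 p.2) - tailQ N E σ p.2 (T p.1 p.2))) := by
    rintro p ⟨h1, h⟩
    have h2 := h1.trans_le h
    rw [if_neg (not_lt.2 h), htrue p h1 h2, hfalse p h1 h2]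
  have hc₃ : ∀ p ∈ {p : ℝ × ℝ | 0 < p.1 ∧ 0 < p.2}, jointDensity ‖α‖ σh p.1 p.2 *
        (1 / 2 - 1 / 2 * (bitTail N E σ T true p - bitTail N E σ T false p) ^ 2) =
      jointDensity ‖α‖ σh p.1 p.2 *
        (1 / 2 - 1 / 2 * (tailQ N E σ p.2 (T p.1 p.2) - tailQ N E σ p.1 (T p.1 p.2)) ^ 2) := by
    rintro p ⟨h1, h2⟩
    rw [htrue p h1 h2, hfalse p h1 h2]
  rw [hunion, integrableOn_union] at hint₁
  rw [hunion, setIntegral_union hdisj hD₂ hint₁.1 hint₁.2, setIntegral_congr_fun hD₁ hc₁,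
    setIntegral_congr_fun hD₂ hc₂] at heq₁
  rw [integrableOn_congr_fun hc₁ hD₁, integrableOn_congr_fun hc₂ hD₂] at hint₁
  have hD₃ : MeasurableSet {p : ℝ × ℝ | 0 < p.1 ∧ 0 < p.2} :=
    measurableSet_Ioi.prod measurableSet_Ioi
  rw [hQ, integrableOn_congr_fun hc₃ hD₃] at hint₂
  rw [hQ, setIntegral_congr_fun hD₃ hc₃] at heq₂
  refine ⟨⟨hint₁.1, hint₁.2, ?_⟩, hint₂, ?_⟩
  · rw [setIntegral_region (S := Set.Ioi 0) (R := fun μ => Set.Ioo 0 μ) measurableSet_Ioi hD₁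
        (fun _ => measurableSet_Ioo) (fun p => Iff.rfl) hint₁.1,
      setIntegral_region (S := Set.Ioi 0) (R := fun μ => Set.Ici μ) measurableSet_Ioi hD₂
        (fun _ => measurableSet_Ici) (fun p => Iff.rfl) hint₁.2] at heq₁
    exact heq₁
  · rw [setIntegral_region (S := Set.Ioi 0) (R := fun _ => Set.Ioi 0) measurableSet_Ioi hD₃
        (fun _ => measurableSet_Ioi) (fun p => Iff.rfl) hint₂] at heq₂
    exact heq₂
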